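/- Let $r\ge 1$. For a finite group $G$ and a finite $G$-poset $\Pi$, the $r$-th equivariant reduced Euler characteristic is $$\widetilde\chi_r(\Pi,G)=\frac1{|G|}\sum_{X\in\operatorname{Hom}(\mathbf Z^r,G)}\widetilde\chi\big(C_\Pi(X(\mathbf Z^r))\big),$$ where $C_\Pi(X(\mathbf Z^r))$ is the subposet of elements of $\Pi$ fixed by the image of $X$, and $\widetilde\chi$ is the reduced Euler characteristic of a finite poset, i.e. of its order complex (so $\widetilde\chi(\emptyset)=-1$). For a prime power $q$ and $n\ge1$, let $\mathrm L_n^*(\mathbf F_q)$ be the $\mathrm{GL}_n(\mathbf F_q)$-poset of subspaces of $\mathbf F_q^n$ other than $0$ and $\mathbf F_q^n$, ordered by inclusion, and let $$F_r(x)(q)=1+\sum_{n\ge1}\widetilde\chi_r\big(\mathrm L_n^*(\mathbf F_q),\mathrm{GL}_n(\mathbf F_q)\big)\,x^n$$ be the $r$-th generating function at $q$. Then there is a power series $F_r(x)\in\mathbf Z[q][[x]]$, independent of the prime power, whose evaluation at every prime power $q$ is $F_r(x)(q)$; in particular $F_r(x)(q)\in\mathbf Z[[x]]$. Moreover, for every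 prime power $q$, $$F_r(x)(q)=\exp\Big(-\sum_{n\ge1}(q^n-1)^{r-1}\frac{x^n}{n}\Big)$$ as formal power series over $\mathbf Q$ (with $(q^n-1)^0=1$). -/

import Mathlib

open scoped PowerSeries Polynomial

/-- The reduced Euler characteristic of a finite poset `P`, that is, of its order complex: the
alternating sum over all finite chains, the empty chain (of dimension `-1`) included, of
`(-1) ^ dim`. A chain with `k` elements has dimension `k - 1`; in particular the value at the
empty poset is `-1`. -/
noncomputable def reducedEulerChar (P : Type*) [PartialOrder P] [Finite P] : ℤ :=
  ∑ᶠ c : {c : Finset P // IsChain (· ≤ ·) (c : Set P)}, (-1) ^ (c.1.card + 1)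

/-- The free abelian group `ℤ ^ r`, written multiplicatively. -/
abbrev FreeAb (r : ℕ) : Type := Multiplicative (Fin r → ℤ)

/-- There are only finitely many homomorphisms from `ℤ ^ r` to a finite group, so that the sum in
`equivariantReducedEulerChar` is a genuine finite sum. -/
instance FreeAb.finite_hom (r : ℕ) (G : Type*) [Group G] [Finite G] : Finite (FreeAb r →* G) := by
  refine Finite.of_injective
    (fun (X : FreeAb r →* G) (i : Fin r) => X (Multiplicative.ofAdd (Pi.single i 1))) ?_
  intro X Y h
  have key : ∀ (i : Fin r) (m : ℤ), X (Multiplicative.ofAdd (Pi.single i m)) =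
      Y (Multiplicative.ofAdd (Pi.single i m)) := by
    intro i m
    have e : (Multiplicative.ofAdd (Pi.single i m : Fin r → ℤ) : FreeAb r) =
        Multiplicative.ofAdd (Pi.single i 1 : Fin r → ℤ) ^ m := by
      rw [← ofAdd_zsmul, ← Pi.single_smul]
      simp
    rw [e, map_zpow, map_zpow]
    exact congrArg (· ^ m) (congrFun h i)
  refine MonoidHom.ext fun v => ?_
  have hv : v = ∏ i, (Multiplicative.ofAdd (Pi.single i (v.toAdd i) : Fin r → ℤ) : FreeAb r) := by
    rw [← ofAdd_sum, Finset.univ_sum_single, ofAdd_toAdd]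
  have hmem : v ∈ X.eqLocus Y := by
    rw [hv]
    exact Subgroup.prod_mem _ fun i _ => key i _
  exact hmem

/-- The `r`-th equivariant reduced Euler characteristic of a finite `G`-poset `P`, for a finite
group `G`: the sum over all homomorphisms `X : ℤ ^ r → G` of the reduced Euler characteristic of
the subposet of `P` fixed by the image of `X`, divided by the order of `G`. -/
noncomputable def equivariantReducedEulerChar (r : ℕ) (P G : Type*) [PartialOrder P] [Finite P]
    [Group G] [Finite G] [MulAction G P] : ℚ :=
  (∑ᶠ X : FreeAb r →* G, (reducedEulerChar (MulAction.fixedPoints X.range P) : ℚ)) / Nat.card G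

/-- The poset of nontrivial proper subspaces of a vector space `V`, ordered by inclusion. -/
abbrev ProperSubspace (K V : Type*) [Field K] [AddCommGroup V] [Module K V] : Type _ :=
  {W : Submodule K V // W ≠ ⊥ ∧ W ≠ ⊤}

/-- The general linear group of `V` acts on nontrivial proper subspaces by taking images:
`g • W = {g w | w ∈ W}`. -/
instance ProperSubspace.mulAction (K V : Type*) [Field K] [AddCommGroup V] [Module K V] :
    MulAction (LinearMap.GeneralLinearGroup K V) (ProperSubspace K V) where
  smul g W := ⟨W.1.map (g : V →ₗ[K] V), by
    have hinj : Function.Injective (g : V →ₗ[K] V) :=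
      (LinearMap.GeneralLinearGroup.toLinearEquiv g).injective
    have hsurj : Function.Surjective (g : V →ₗ[K] V) :=
      (LinearMap.GeneralLinearGroup.toLinearEquiv g).surjective
    refine ⟨fun h => W.2.1 ?_, fun h => W.2.2 ?_⟩
    · exact Submodule.map_injective_of_injective hinj (h.trans (Submodule.map_bot _).symm)
    · exact Submodule.map_injective_of_injective hinj
        (h.trans ((Submodule.map_top _).trans (LinearMap.range_eq_top.2 hsurj)).symm)⟩
  one_smul W := Subtype.ext (Submodule.map_id W.1)
  mul_smul g h W := Subtype.ext (Submodule.map_comp (h : V →ₗ[K] V) (g : V →ₗ[K] V) W.1)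

instance finite_generalLinearGroup (K V : Type*) [Field K] [AddCommGroup V] [Module K V]
    [Finite V] : Finite (LinearMap.GeneralLinearGroup K V) :=
  haveI : Finite (V →ₗ[K] V) := Finite.of_injective (fun f => (f : V → V)) DFunLike.coe_injective
  Finite.of_injective (fun g => (g : V →ₗ[K] V)) fun _ _ h => Units.ext h

/-- The `r`-th generating function at `q`, where `K` is the finite field with `q` elements: the
constant coefficient is `1`, and for `n ≥ 1` the coefficient of `x ^ n` is the `r`-th equivariant
reduced Euler characteristic of the `GL_n(K)`-poset of nontrivial proper subspaces of `K ^ n`. -/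
noncomputable def generatingFunction (r : ℕ) (K : Type*) [Field K] [Finite K] : ℚ⟦X⟧ :=
  PowerSeries.mk fun n =>
    if n = 0 then 1
    else equivariantReducedEulerChar r (ProperSubspace K (Fin n → K))
      (LinearMap.GeneralLinearGroup K (Fin n → K))

/-- The power series `∑_{n ≥ 1} (q ^ n - 1) ^ (r - 1) x ^ n / n` over `ℚ`, for `r ≥ 1`. -/
noncomputable def exponentSeries (r q : ℕ) : ℚ⟦X⟧ :=
  PowerSeries.mk fun n => if n = 0 then 0 else ((q : ℚ) ^ n - 1) ^ (r - 1) / n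

section

open Classical Finset

attribute [local instance] Fintype.ofFinite

/-! ### Reduced Euler characteristics and Möbius numbers of finite posets -/

/-! Write q = |K|, and let T_r be the series whose n-th coefficient is |GL_n|⁻¹ times the sum, over
commuting r-tuples Y in GL_n, of the Möbius number μ(Y) of the lattice of Y-invariant subspaces. A
homomorphism from ℤ^r is a commuting r-tuple, and for n ≥ 1 its fixed poset is this lattice without
top and bottom, so T_r is the generating function. Everything follows from T_{r+1}(x) T_r(x) =
T_r(qx) (`tupleSeries_succ_mul`) and T_1 = 1 - x.

For the functional equation, sum μ(f, Y) over commuting r-tuples Y of automorphisms of V and all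
endomorphisms f commuting with Y. For fixed Y the sum over f is |V| μ(Y): this is `sumEndMob_eq` for
V as a module over the commutative algebra K[Y], proved by reduction to vector spaces over a finite
field. On the other hand, the Fitting decomposition of f splits V into a part where f is nilpotent
and a part where f is invertible, and μ is multiplicative along it. A nonzero nilpotent f forces μ =
0 (`invMob_eq_zero_of_isNilpotent`), so the nilpotent part contributes to T_r and the invertible
part to T_{r+1} (`sum_headTuples_idemPow_eq`).

Iterating T_{r+1}(x) = T_r(qx) / T_r(x) from 1 - x stays within series over ℤ[q]. The exponents obey
the additive form of this recursion, since (q^n - 1)^r + (q^n - 1)^(r-1) = q^n (q^n - 1)^(r-1). -/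

theorem reducedEulerChar_eq_sum (P : Type*) [PartialOrder P] [Fintype P] :
    reducedEulerChar P =
      ∑ c ∈ (univ : Finset (Finset P)).filter (fun c : Finset P => IsChain (· ≤ ·) (c : Set P)),
        (-1) ^ (c.card + 1) := by
  rw [reducedEulerChar, finsum_eq_sum_of_fintype]
  exact (Finset.sum_subtype _ (by simp) (fun c : Finset P => (-1 : ℤ) ^ (c.card + 1))).symm

theorem reducedEulerChar_congr {P Q : Type*} [PartialOrder P] [Finite P] [PartialOrder Q]
    [Finite Q] (e : P ≃o Q) : reducedEulerChar P = reducedEulerChar Q := by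
  rw [reducedEulerChar_eq_sum, reducedEulerChar_eq_sum]
  refine Finset.sum_equiv (Equiv.finsetCongr e.toEquiv) (fun c => ?_) (fun c _ => ?_)
  · simp only [mem_filter, mem_univ, true_and, Equiv.finsetCongr_apply, coe_map]
    constructor
    · intro h
      rintro _ ⟨a, ha, rfl⟩ _ ⟨b, hb, rfl⟩ hne
      simpa using h ha hb (fun hab => hne (by rw [hab]))
    · intro h x hx y hy hne
      have := h (Set.mem_image_of_mem _ hx) (Set.mem_image_of_mem _ hy)
        (fun h' => hne (e.injective (by simpa using h')))
      simpa using this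
  · simp

/-- Splitting off the largest element of a nonempty chain. -/
theorem reducedEulerChar_eq_neg_one_sub_sum (P : Type*) [PartialOrder P] [Fintype P] :
    reducedEulerChar P = -1 - ∑ x : P, reducedEulerChar {y : P // y < x} := by
  have key : ∑ c ∈ (univ : Finset (Finset P)).filter (fun c : Finset P =>
      IsChain (· ≤ ·) (c : Set P) ∧ c.Nonempty), (-1 : ℤ) ^ (c.card + 1)
      = - ∑ x : P, reducedEulerChar {y : P // y < x} := by
    simp_rw [reducedEulerChar_eq_sum]
    rw [Finset.sum_sigma', ← Finset.sum_neg_distrib]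
    symm
    have hnot : ∀ (x : P) (c : Finset {y : P // y < x}),
        x ∉ c.map (Function.Embedding.subtype _) := by
      intro x c h
      obtain ⟨y, -, hy⟩ := Finset.mem_map.1 h
      exact absurd y.2 (by simp at hy; simp [hy])
    refine Finset.sum_bij
      (fun s _ => insert s.1 (s.2.map (Function.Embedding.subtype _))) ?_ ?_ ?_ ?_
    · rintro ⟨x, c⟩ hc
      simp only [mem_sigma, mem_univ, mem_filter, true_and] at hc ⊢
      refine ⟨?_, by simp⟩
      rw [coe_insert, coe_map]
      refine IsChain.insert ?_ ?_
      · rintro _ ⟨a, ha, rfl⟩ _ ⟨b, hb, rfl⟩ hne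
        exact hc ha hb (fun hab => hne (by rw [hab]))
      rintro _ ⟨b, -, rfl⟩ -
      exact Or.inr b.2.le
    · rintro ⟨x, c⟩ hc ⟨x', c'⟩ hc' h
      simp only at h
      have hx : x = x' := by
        have h1 : x ∈ insert x' (c'.map (Function.Embedding.subtype _)) := h ▸ mem_insert_self _ _
        have h2 : x' ∈ insert x (c.map (Function.Embedding.subtype _)) := h ▸ mem_insert_self _ _
        simp only [mem_insert, mem_map, Function.Embedding.subtype_apply] at h1 h2
        rcases h1 with h1 | ⟨y, -, h1⟩
        · exact h1
        rcases h2 with h2 | ⟨z, -, h2⟩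
        · exact h2.symm
        exact absurd (h1 ▸ y.2) (h2 ▸ z.2).not_gt
      subst hx
      have := congrArg (fun s => s.erase x) h
      simp only [erase_insert (hnot _ _)] at this
      rw [Finset.map_injective _ this]
    · intro c hc
      simp only [mem_filter, mem_univ, true_and] at hc
      obtain ⟨x, hx⟩ := c.exists_maximal hc.2
      have hlt : ∀ y ∈ c, y ≠ x → y < x := by
        intro y hy hne
        rcases hc.1 hy hx.1 hne with h | h
        · exact lt_of_le_of_ne h hne
        · exact absurd (le_antisymm (hx.2 hy h) h) hne
      refine ⟨⟨x, (c.erase x).subtype (· < x)⟩, ?_, ?_⟩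
      · simp only [mem_sigma, mem_univ, mem_filter, true_and]
        intro a ha b hb hne
        simp only [SetLike.mem_coe, mem_subtype, mem_erase] at ha hb
        exact hc.1 ha.2 hb.2 (fun h => hne (Subtype.ext h))
      · ext y
        simp only [mem_insert, mem_map, mem_subtype, mem_erase, Function.Embedding.subtype_apply]
        constructor
        · rintro (rfl | ⟨a, ha, rfl⟩)
          · exact hx.1
          · exact ha.2
        · intro hy
          by_cases h : y = x
          · exact Or.inl h
          · exact Or.inr ⟨⟨y, hlt y hy h⟩, ⟨h, hy⟩, rfl⟩
    · rintro ⟨x, c⟩ hc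
      rw [card_insert_of_notMem (hnot _ _), card_map]
      ring
  rw [reducedEulerChar_eq_sum, sub_eq_add_neg, ← key]
  have : (univ.filter fun c : Finset P => IsChain (· ≤ ·) (c : Set P)) =
      insert ∅ (univ.filter fun c : Finset P => IsChain (· ≤ ·) (c : Set P) ∧ c.Nonempty) := by
    ext c
    by_cases h : c = ∅
    · subst h; simp
    · simp [h, Finset.nonempty_iff_ne_empty]
  rw [this, sum_insert (by simp)]
  simp

/-! ### Möbius numbers of finite posets with a least element. -/

section mob

variable {L L' : Type*} [PartialOrder L'] [OrderBot L'] [Finite L']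
  [PartialOrder L] [OrderBot L] [Finite L]

/-- The Möbius number `μ(⊥, x)`, as the reduced Euler characteristic of the open interval. -/
noncomputable def mob (x : L) : ℤ :=
  if x = ⊥ then 1 else reducedEulerChar {y : L // y ≠ ⊥ ∧ y < x}

@[simp] theorem mob_bot : mob (⊥ : L) = 1 := if_pos rfl

/-- The part of the open interval (⊥, x) strictly below y is (⊥, y), so splitting chains by their
largest element gives the Möbius recursion; the empty chain accounts for the term `mob ⊥ = 1`. -/
theorem sum_mob [Fintype L] (x : L) : ∑ y with y ≤ x, mob y = if x = ⊥ then 1 else 0 := by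
  split_ifs with hx
  · subst hx
    have : (univ.filter fun y : L => y ≤ ⊥) = {⊥} := by ext; simp
    rw [this, sum_singleton, mob_bot]
  · have hmob : mob x = -1 - ∑ y : {y : L // y ≠ ⊥ ∧ y < x}, mob y.1 := by
      rw [mob, if_neg hx, reducedEulerChar_eq_neg_one_sub_sum]
      congr 1
      refine Finset.sum_congr rfl fun y _ => ?_
      rw [mob, if_neg y.2.1]
      refine reducedEulerChar_congr
        { toFun := fun z => ⟨z.1.1, z.1.2.1, z.2⟩
          invFun := fun z => ⟨⟨z.1, z.2.1, z.2.2.trans y.2.2⟩, z.2.2⟩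
          left_inv := fun _ => rfl
          right_inv := fun _ => rfl
          map_rel_iff' := Iff.rfl }
    have hsplit : (univ.filter fun y : L => y ≤ x) =
        insert x (insert ⊥ (univ.filter fun y : L => y ≠ ⊥ ∧ y < x)) := by
      ext y
      simp only [mem_filter, mem_univ, true_and, mem_insert]
      constructor
      · intro h
        by_cases h1 : y = x
        · exact Or.inl h1
        · by_cases h2 : y = ⊥
          · exact Or.inr (Or.inl h2)
          · exact Or.inr (Or.inr ⟨h2, lt_of_le_of_ne h h1⟩)
      · rintro (rfl | rfl | h)
        · exact le_rfl
        · exact bot_le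
        · exact h.2.le
    rw [hsplit, sum_insert (by simp [hx]), sum_insert (by simp), hmob, mob_bot,
      Finset.sum_subtype _ (p := fun y : L => y ≠ ⊥ ∧ y < x) (by simp)]
    ring

/-- The defining recursion determines the Möbius numbers. -/
theorem eq_mob_of_sum [Fintype L] (g : L → ℤ)
    (hg : ∀ x, ∑ y with y ≤ x, g y = if x = ⊥ then 1 else 0) (x : L) : g x = mob x := by
  induction x using WellFoundedLT.induction with
  | ind x ih =>
    have h := (hg x).trans (sum_mob x).symm
    have hsplit : (univ.filter fun y : L => y ≤ x) = insert x (univ.filter fun y : L => y < x) := by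
      ext y; simp [le_iff_eq_or_lt]
    rw [hsplit, sum_insert (by simp), sum_insert (by simp),
      Finset.sum_congr rfl fun y hy => ih y (by simpa using hy)] at h
    exact add_right_cancel h

theorem mob_orderIso_Iic (x : L) (x' : L') (e : {y : L // y ≤ x} ≃o {y : L' // y ≤ x'}) :
    mob x = mob x' := by
  have hbot : (e ⟨⊥, bot_le⟩ : L') = ⊥ := by
    have h : e ⟨⊥, bot_le⟩ ≤ ⟨⊥, bot_le⟩ := by
      rw [← e.le_symm_apply]; exact Subtype.mk_le_mk.2 bot_le
    exact le_bot_iff.1 h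
  have htop : e ⟨x, le_rfl⟩ = ⟨x', le_rfl⟩ := by
    refine le_antisymm (e ⟨x, le_rfl⟩).2 ?_
    rw [← e.symm_apply_le]
    exact (e.symm ⟨x', le_rfl⟩).2
  by_cases hx : x = ⊥
  · subst hx
    have : x' = ⊥ := by rw [← hbot, htop]
    rw [this, mob_bot, mob_bot]
  · have hx' : x' ≠ ⊥ := by
      rintro rfl
      apply hx
      have := e.injective (htop.trans (Subtype.ext hbot).symm)
      simpa using this
    rw [mob, mob, if_neg hx, if_neg hx']
    have hne : ∀ y : {y : L // y ≤ x}, (e y : L') = ⊥ ↔ (y : L) = ⊥ := by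
      intro y
      constructor
      · intro h
        have := e.injective ((Subtype.ext (h.trans hbot.symm)) : e y = e ⟨⊥, bot_le⟩)
        simp [this]
      · intro h
        rw [← hbot]; congr 2; exact Subtype.ext h
    have hlt : ∀ y : {y : L // y ≤ x}, (e y : L') < x' ↔ (y : L) < x := by
      intro y
      have : e y < e ⟨x, le_rfl⟩ ↔ y < ⟨x, le_rfl⟩ := e.lt_iff_lt
      rw [htop] at this
      exact this
    refine reducedEulerChar_congr
        { toFun := fun y => ⟨e ⟨y.1, y.2.2.le⟩, (hne _).not.2 y.2.1, (hlt _).2 y.2.2⟩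
          invFun := fun y => ⟨e.symm ⟨y.1, y.2.2.le⟩, (hne _).not.1 (by simpa using y.2.1),
            (hlt _).1 (by simpa using y.2.2)⟩
          left_inv := fun y => Subtype.ext (by simp)
          right_inv := fun y => Subtype.ext (by simp)
          map_rel_iff' := ?_ }
    intro a b
    exact e.le_iff_le (x := ⟨a.1, a.2.2.le⟩) (y := ⟨b.1, b.2.2.le⟩)

theorem mob_orderIso_top [OrderTop L'] (x : L) (e : {y : L // y ≤ x} ≃o L') :
    mob x = mob (⊤ : L') :=
  mob_orderIso_Iic x ⊤ (e.trans
    { toFun := fun y => ⟨y, le_top⟩, invFun := fun y => y.1, left_inv := fun _ => rfl,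
      right_inv := fun _ => rfl, map_rel_iff' := Iff.rfl })

theorem mob_top_congr [OrderTop L] [OrderTop L'] (e : L ≃o L') :
    mob (⊤ : L) = mob (⊤ : L') :=
  mob_orderIso_top ⊤ (OrderIso.trans
    { toFun := fun y => y.1, invFun := fun y => ⟨y, le_top⟩, left_inv := fun _ => rfl,
      right_inv := fun _ => rfl, map_rel_iff' := Iff.rfl } e)

/-- Lower sets in a product are products of lower sets, so the product of Möbius numbers satisfies
the recursion that determines `mob`. -/
theorem mob_prod (x : L) (x' : L') : mob (x, x') = mob x * mob x' := by
  refine (eq_mob_of_sum (fun z : L × L' => mob z.1 * mob z.2) (fun z => ?_) (x, x')).symm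
  trans ∑ y ∈ (univ.filter fun y : L => y ≤ z.1) ×ˢ (univ.filter fun y : L' => y ≤ z.2),
      mob y.1 * mob y.2
  · exact Finset.sum_congr (by ext y; simp [Prod.le_def]) fun _ _ => rfl
  rw [Finset.sum_product]
  simp_rw [← Finset.mul_sum, ← Finset.sum_mul, sum_mob]
  by_cases h1 : z.1 = ⊥ <;> by_cases h2 : z.2 = ⊥ <;> simp [h1, h2, Prod.ext_iff]

/-- If a closure operator moves `⊥` but only `⊤` has closure `⊤`, then `μ(⊥, ⊤) = 0`. -/
theorem mob_top_eq_zero_of_closure [OrderTop L] (φ : ClosureOperator L)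
    (hbot : φ ⊥ ≠ ⊥) (htop : ∀ x, φ x = ⊤ → x = ⊤) : mob (⊤ : L) = 0 := by
  -- Each fibre of φ over a closed y has Möbius sum zero: since ⊥ is not closed, the sum over all x
  -- ≤ y vanishes, and by induction so do the fibres over smaller closed elements. The fibre over ⊤
  -- is {⊤}.
  have key : ∀ y : L, φ y = y → ∑ x with φ x = y, mob x = 0 := by
    intro y
    induction y using WellFoundedLT.induction with
    | ind y ih =>
      intro hy
      have hy0 : y ≠ ⊥ := by
        rintro rfl; exact hbot hy
      have h := sum_mob y
      rw [if_neg hy0] at h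
      rw [← Finset.sum_fiberwise_of_maps_to (f := mob)
        (t := univ.filter fun z : L => z ≤ y) (g := φ)] at h
      · rw [← h]
        refine Eq.trans ?_ (Finset.sum_eq_single_of_mem y (by simp) ?_).symm
        · refine Finset.sum_congr ?_ fun _ _ => rfl
          ext x
          simp only [mem_filter, mem_univ, true_and]
          exact ⟨fun hx => ⟨hx ▸ φ.le_closure x, hx⟩, fun hx => hx.2⟩
        · intro z hz hzy
          simp only [mem_filter, mem_univ, true_and] at hz
          by_cases hz' : φ z = z
          · rw [← ih z (lt_of_le_of_ne hz hzy) hz']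
            refine Finset.sum_congr ?_ fun _ _ => rfl
            ext x
            simp only [mem_filter, mem_univ, true_and]
            exact ⟨fun hx => hx.2, fun hx => ⟨(φ.le_closure x).trans (hx.le.trans hz), hx⟩⟩
          · refine Finset.sum_eq_zero fun x hx => absurd ?_ hz'
            simp only [mem_filter, mem_univ, true_and] at hx
            rw [← hx.2, φ.idempotent]
      · intro x hx
        simp only [mem_filter, mem_univ, true_and] at hx ⊢
        rw [← hy]
        exact φ.monotone hx
  have := key ⊤ (top_le_iff.1 (φ.le_closure ⊤))
  rw [Finset.sum_eq_single ⊤] at this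
  · exact this
  · intro x hx hne
    exact absurd (htop x (by simpa using hx)) hne
  · intro h
    exact absurd (top_le_iff.1 (φ.le_closure ⊤)) (by simp at h)

end mob

/-! ### Posets of invariant submodules -/

instance LinearMap.finite_of_finite {R V W : Type*} [Semiring R] [AddCommMonoid V] [Module R V]
    [AddCommMonoid W] [Module R W] [Finite V] [Finite W] : Finite (V →ₗ[R] W) :=
  DFunLike.finite _

instance LinearEquiv.finite_of_finite {R V W : Type*} [Semiring R] [AddCommMonoid V] [Module R V]
    [AddCommMonoid W] [Module R W] [Finite V] [Finite W] : Finite (V ≃ₗ[R] W) :=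
  DFunLike.finite _

section InvSub

variable {R V V' ι : Type*} [Ring R] [AddCommGroup V'] [Module R V']
  [AddCommGroup V] [Module R V]

/-- The submodules invariant under a family of endomorphisms. -/
abbrev InvSub (Y : ι → Module.End R V) : Type _ :=
  {W : Submodule R V // ∀ i, W ≤ W.comap (Y i)}

instance (Y : ι → Module.End R V) : BoundedOrder (InvSub Y) where
  top := ⟨⊤, fun _ _ _ => trivial⟩
  le_top W := (le_top : W.1 ≤ ⊤)
  bot := ⟨⊥, fun _ => bot_le⟩
  bot_le W := (bot_le : ⊥ ≤ W.1)

@[simp] theorem InvSub.coe_bot (Y : ι → Module.End R V) : ((⊥ : InvSub Y) : Submodule R V) = ⊥ :=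
  rfl

variable [Finite V'] [Finite V]

/-- The Möbius number of the lattice of invariant submodules. -/
noncomputable def invMob (Y : ι → Module.End R V) : ℤ := mob (⊤ : InvSub Y)

theorem invMob_congr {Y : ι → Module.End R V} {Y' : ι → Module.End R V'} (e : V ≃ₗ[R] V')
    (h : ∀ i v, e (Y i v) = Y' i (e v)) : invMob Y = invMob Y' := by
  refine mob_top_congr
    { toFun := fun W => ⟨W.1.map (e : V →ₗ[R] V'), ?_⟩
      invFun := fun W => ⟨W.1.comap (e : V →ₗ[R] V'), ?_⟩
      left_inv := fun W => Subtype.ext (Submodule.comap_map_eq_of_injective e.injective _)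
      right_inv := fun W => Subtype.ext (Submodule.map_comap_eq_of_surjective e.surjective _)
      map_rel_iff' := ?_ }
  · rintro i _ ⟨v, hv, rfl⟩
    exact ⟨Y i v, W.2 i hv, h i v⟩
  · intro i v hv
    have := W.2 i hv
    simp only [Submodule.mem_comap, LinearEquiv.coe_coe] at this ⊢
    rwa [h]
  · intro W W'
    exact Submodule.map_le_map_iff_of_injective e.injective _ _

/-- The Möbius number only depends on which subsets are invariant submodules. -/
theorem invMob_congr_coe {R' ι' : Type*} [Ring R'] [Module R' V] {Y : ι → Module.End R V}
    {Y' : ι' → Module.End R' V} (h : ∀ W : InvSub Y, ∃ W' : InvSub Y', (W'.1 : Set V) = W.1)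
    (h' : ∀ W' : InvSub Y', ∃ W : InvSub Y, (W.1 : Set V) = W'.1) : invMob Y = invMob Y' := by
  choose g hg using h
  choose g' hg' using h'
  refine mob_top_congr
    { toFun := g
      invFun := g'
      left_inv := fun W => Subtype.ext (SetLike.coe_injective (by rw [hg', hg]))
      right_inv := fun W => Subtype.ext (SetLike.coe_injective (by rw [hg, hg']))
      map_rel_iff' := ?_ }
  intro a b
  change ((g a).1 : Set V) ⊆ (g b).1 ↔ (a.1 : Set V) ⊆ b.1
  rw [hg, hg]

theorem invMob_eq_mob_top (Y : ι → Module.End R V)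
    (h : ∀ i (W : Submodule R V), W ≤ W.comap (Y i)) :
    invMob Y = mob (⊤ : Submodule R V) :=
  mob_top_congr
    { toFun := fun W => W.1
      invFun := fun W => ⟨W, fun i => h i W⟩
      left_inv := fun _ => rfl
      right_inv := fun _ => rfl
      map_rel_iff' := Iff.rfl }

theorem invMob_zero : invMob (fun _ : ι => (0 : Module.End R V)) = mob (⊤ : Submodule R V) :=
  invMob_eq_mob_top _ fun _ W v _ => by simp

theorem invMob_of_subsingleton [Subsingleton V] (Y : ι → Module.End R V) : invMob Y = 1 := by
  have : (⊤ : InvSub Y) = ⊥ := Subsingleton.elim _ _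
  rw [invMob, this, mob_bot]

theorem mob_invSub_eq (Y : ι → Module.End R V) (W : InvSub Y) :
    mob W = invMob fun i => (Y i).restrict (W.2 i) := by
  refine mob_orderIso_top W
    { toFun := fun U => ⟨U.1.1.comap W.1.subtype, fun i v hv => U.1.2 i hv⟩
      invFun := fun U => ⟨⟨U.1.map W.1.subtype, ?_⟩, ?_⟩
      left_inv := fun U => Subtype.ext (Subtype.ext ?_)
      right_inv := fun U => Subtype.ext (Submodule.comap_map_eq_of_injective
        W.1.subtype_injective _)
      map_rel_iff' := ?_ }
  · rintro i _ ⟨v, hv, rfl⟩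
    exact ⟨_, U.2 i hv, rfl⟩
  · exact Submodule.map_subtype_le _ _
  · exact (Submodule.map_comap_subtype _ _).trans (inf_eq_right.2 U.2)
  · intro a b
    constructor
    · intro h v hv
      exact h (show (⟨v, a.2 hv⟩ : W.1) ∈ a.1.1.comap W.1.subtype from hv)
    · intro h v hv
      exact h hv

theorem mob_submodule_eq (W : Submodule R V) : mob W = mob (⊤ : Submodule R W) :=
  mob_orderIso_top W W.mapIic.symm

theorem mob_submodule_congr (e : V ≃ₗ[R] V') :
    mob (⊤ : Submodule R V) = mob (⊤ : Submodule R V') :=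
  mob_top_congr (Submodule.orderIsoMapComap e)

/-- The Möbius number of a direct sum whose invariant submodules are compatible with the
decomposition. -/
theorem invMob_prodMap {U₀ U₁ : Type*} [AddCommGroup U₀] [Module R U₀] [AddCommGroup U₁]
    [Module R U₁] [Finite U₀] [Finite U₁] (Y₀ : ι → Module.End R U₀) (Y₁ : ι → Module.End R U₁)
    (hp : ∀ W : InvSub (fun i => (Y₀ i).prodMap (Y₁ i)), ∀ u ∈ W.1, ((0, u.2) : U₀ × U₁) ∈ W.1) :
    invMob (fun i => (Y₀ i).prodMap (Y₁ i)) = invMob Y₀ * invMob Y₁ := by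
  rw [invMob, invMob, invMob, ← mob_prod]
  have hp' : ∀ W : InvSub (fun i => (Y₀ i).prodMap (Y₁ i)), ∀ u ∈ W.1,
      ((u.1, 0) : U₀ × U₁) ∈ W.1 := by
    intro W u hu
    have h : ((u.1, 0) : U₀ × U₁) = u - (0, u.2) := by ext <;> simp
    rw [h]
    exact W.1.sub_mem hu (hp W u hu)
  refine mob_top_congr (L' := InvSub Y₀ × InvSub Y₁)
    { toFun := fun W => (⟨W.1.comap (LinearMap.inl R U₀ U₁), ?_⟩,
        ⟨W.1.comap (LinearMap.inr R U₀ U₁), ?_⟩)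
      invFun := fun W => ⟨W.1.1.prod W.2.1, ?_⟩
      left_inv := fun W => ?_
      right_inv := fun W => ?_
      map_rel_iff' := ?_ }
  · intro i v hv
    simpa using W.2 i hv
  · intro i v hv
    simpa using W.2 i hv
  · intro i v hv
    exact ⟨W.1.2 i hv.1, W.2.2 i hv.2⟩
  · ext ⟨u, v⟩
    simp only [Submodule.mem_prod, Submodule.mem_comap, LinearMap.inl_apply, LinearMap.inr_apply]
    constructor
    · rintro ⟨h1, h2⟩
      simpa using W.1.add_mem h1 h2
    · intro h
      exact ⟨hp' W _ h, hp W _ h⟩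
  · ext v <;> simp
  · intro W W'
    constructor
    · rintro ⟨h1, h2⟩ u hu
      have := W'.1.add_mem (h1 (hp' W u hu)) (h2 (hp W u hu))
      simpa using this
    · intro h
      exact ⟨fun u hu => h hu, fun u hu => h hu⟩

/-- The Möbius number vanishes in the presence of a nonzero nilpotent commuting operator that
preserves all invariant submodules. -/
theorem invMob_eq_zero_of_isNilpotent (Y : ι → Module.End R V) (g : Module.End R V)
    (hg : IsNilpotent g) (hg0 : g ≠ 0) (hcomm : ∀ i, Commute g (Y i))
    (hinv : ∀ W : InvSub Y, W.1 ≤ W.1.comap g) : invMob Y = 0 := by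
  -- The closure operator is W ↦ W + gV; it moves 0 because g ≠ 0.
  refine mob_top_eq_zero_of_closure (ClosureOperator.mk'
    (fun W => ⟨W.1 ⊔ LinearMap.range g, fun i => ?_⟩ : InvSub Y → InvSub Y) ?_ ?_ ?_) ?_ ?_
  · refine sup_le ((W.2 i).trans (Submodule.comap_mono le_sup_left)) ?_
    rintro _ ⟨v, rfl⟩
    refine Submodule.mem_sup_right ⟨Y i v, ?_⟩
    exact LinearMap.congr_fun (hcomm i) v
  · intro W W' h
    exact sup_le_sup_right (show W.1 ≤ W'.1 from h) _
  · intro W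
    exact (le_sup_left : W.1 ≤ _)
  · intro W
    exact (sup_le le_rfl le_sup_right : (W.1 ⊔ LinearMap.range g) ⊔ LinearMap.range g ≤ _)
  · intro h
    have h : ((⊥ : InvSub Y) : Submodule R V) ⊔ LinearMap.range g = ⊥ := congrArg Subtype.val h
    rw [InvSub.coe_bot, bot_sup_eq, LinearMap.range_eq_bot] at h
    exact hg0 h
  · intro W h
    have h : W.1 ⊔ LinearMap.range g = ⊤ := congrArg Subtype.val h
    refine Subtype.ext ?_
    -- Since gW ⊆ W, the equality W + gV = V iterates to W + g^k V = V, and nilpotency then gives W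
    -- = V.
    have key : ∀ k : ℕ, W.1 ⊔ LinearMap.range (g ^ k) = ⊤ := by
      intro k
      induction k with
      | zero => simp [Module.End.one_eq_id]
      | succ k ih =>
        rw [eq_top_iff, ← h]
        refine sup_le le_sup_left ?_
        rintro _ ⟨v, rfl⟩
        obtain ⟨w, hw, _, ⟨u, rfl⟩, rfl⟩ := Submodule.mem_sup.1 (ih ▸ Submodule.mem_top : v ∈ _)
        rw [map_add]
        refine add_mem (Submodule.mem_sup_left (hinv W hw)) (Submodule.mem_sup_right ⟨u, ?_⟩)
        rw [pow_succ']
        rfl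
    obtain ⟨k, hk⟩ := hg
    have := key k
    rwa [hk, LinearMap.range_zero, sup_bot_eq] at this

end InvSub

/-! ### The sum of Möbius numbers over all endomorphisms -/

section Ring

variable {R V V' : Type*} [Ring R] [AddCommGroup V] [Module R V] [Finite V]
  [AddCommGroup V'] [Module R V'] [Finite V']

/-- Möbius inversion over kernels: for fixed g, the sum of `mob W` over W ≤ ker g is 1 if ker g = 0
and 0 otherwise. -/
theorem sum_mob_mul_card_le_ker (V : Type*) [AddCommGroup V] [Module R V] [Finite V]
    (N : Type*) [AddCommGroup N] [Module R N] [Finite N] :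
    ∑ W : Submodule R V, mob W * (Nat.card {g : V →ₗ[R] N // W ≤ LinearMap.ker g} : ℤ) =
      Nat.card {g : V →ₗ[R] N // Function.Injective g} := by
  simp_rw [Nat.card_eq_fintype_card, Fintype.card_subtype, Finset.card_filter]
  push_cast
  simp_rw [Finset.mul_sum]
  rw [Finset.sum_comm]
  refine Finset.sum_congr rfl fun g _ => ?_
  simp_rw [mul_ite, mul_one, mul_zero]
  rw [← Finset.sum_filter, sum_mob]
  simp only [LinearMap.ker_eq_bot]

/-- The sum over all endomorphisms of the Möbius number of the lattice of invariant submodules. -/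
noncomputable def sumEndMob (R V : Type*) [Ring R] [AddCommGroup V] [Module R V] [Finite V] : ℤ :=
  ∑ f : Module.End R V, invMob fun _ : Unit => f

theorem sumEndMob_congr (e : V ≃ₗ[R] V') : sumEndMob R V = sumEndMob R V' := by
  refine Fintype.sum_equiv e.conjRingEquiv.toEquiv _ _ fun f => ?_
  exact invMob_congr e fun _ v => by simp

theorem sumEndMob_of_subsingleton [Subsingleton V] : sumEndMob R V = 1 := by
  simp [sumEndMob, invMob_of_subsingleton]

theorem mob_top_of_subsingleton {V : Type*} [AddCommGroup V] [Module R V] [Subsingleton V] :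
    mob (⊤ : Submodule R V) = 1 := by
  rw [Subsingleton.elim (⊤ : Submodule R V) ⊥, mob_bot]

end Ring

/-! ### Endomorphisms of vector spaces over a finite field. -/

section Field

variable {E V : Type*} [Field E] [AddCommGroup V] [Module E V] [Finite V]

theorem card_le_ker (W : Submodule E V) (N : Type*) [AddCommGroup N] [Module E N] [Finite N] :
    Nat.card {g : V →ₗ[E] N // W ≤ LinearMap.ker g} =
      Nat.card E ^ ((Module.finrank E V - Module.finrank E W) * Module.finrank E N) := by
  have e : {g : V →ₗ[E] N // W ≤ LinearMap.ker g} ≃ (V ⧸ W →ₗ[E] N) :=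
    { toFun := fun g => W.liftQ g.1 g.2
      invFun := fun h => ⟨h.comp W.mkQ, fun w hw => by
        simp [(Submodule.Quotient.mk_eq_zero W).2 hw]⟩
      left_inv := fun g => by ext; simp
      right_inv := fun h => by ext; simp }
  rw [Nat.card_congr e, Module.natCard_eq_pow_finrank (K := E), Module.finrank_linearMap,
    Submodule.finrank_quotient]

/-- The extensions of h form a coset of the space of maps V → V vanishing on W. -/
theorem card_extension (W : Submodule E V) (h : Module.End E W) :
    Nat.card {f : Module.End E V // f ∘ₗ W.subtype = W.subtype ∘ₗ h} =
      Nat.card E ^ ((Module.finrank E V - Module.finrank E W) * Module.finrank E V) := by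
  rw [← card_le_ker W V]
  obtain ⟨f₀, hf₀⟩ := LinearMap.exists_extend (W.subtype ∘ₗ h)
  refine Nat.card_congr
    ((Equiv.subRight f₀).subtypeEquiv fun f => ?_)
  simp only [Equiv.subRight_apply]
  rw [← hf₀]
  constructor
  · intro hf w hw
    have := LinearMap.congr_fun hf ⟨w, hw⟩
    simpa [sub_eq_zero] using this
  · intro hf
    ext w
    have := hf w.2
    simpa [sub_eq_zero] using this

/-- The interval below an f-invariant W depends only on the restriction of f to W, and every
endomorphism of W has the same number of extensions to V. -/
theorem sum_end_invMob_restrict (W : Submodule E V) :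
    ∑ f : Module.End E V,
      (if h : ∀ _ : Unit, W ≤ W.comap f then mob (⟨W, h⟩ : InvSub fun _ : Unit => f) else 0) =
      (Nat.card E : ℤ) ^ ((Module.finrank E V - Module.finrank E W) * Module.finrank E V) *
        sumEndMob E W := by
  trans ∑ f : Module.End E V, ∑ h : Module.End E W,
    if f ∘ₗ W.subtype = W.subtype ∘ₗ h then invMob (fun _ : Unit => h) else 0
  · refine Finset.sum_congr rfl fun f _ => ?_
    split_ifs with hf
    · rw [mob_invSub_eq, Finset.sum_eq_single (f.restrict (hf ()))]
      · rw [if_pos]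
        ext w; simp
      · intro h _ hne
        rw [if_neg]
        intro heq
        apply hne
        ext w
        have := LinearMap.congr_fun heq w
        simpa using this.symm
      · simp
    · refine (Finset.sum_eq_zero fun h _ => if_neg ?_).symm
      intro heq
      apply hf
      intro _ w hw
      have := LinearMap.congr_fun heq ⟨w, hw⟩
      simp only [LinearMap.comp_apply, Submodule.subtype_apply] at this
      rw [Submodule.mem_comap, this]
      exact (h ⟨w, hw⟩).2
  · rw [Finset.sum_comm, sumEndMob, Finset.mul_sum]
    refine Finset.sum_congr rfl fun h _ => ?_
    rw [← Finset.sum_filter, Finset.sum_const, nsmul_eq_mul, ← Fintype.card_subtype,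
      ← Nat.card_eq_fintype_card, card_extension, Nat.cast_pow]

/-- Both sides satisfy the same linear recursion over the subspaces W of V, with coefficient 1 at W
= V, so they agree by induction on the dimension. -/
theorem sumEndMob_eq_of_field.{u, v} {E : Type u} [Field E] [Finite E] (n : ℕ) :
    ∀ (V : Type v) [AddCommGroup V] [Module E V] [Finite V], Module.finrank E V = n →
      sumEndMob E V = Nat.card V * mob (⊤ : Submodule E V) := by
  induction n using Nat.strong_induction_on with
  | _ n ih =>
  intro V _ _ _ hn
  rcases Nat.eq_zero_or_pos n with rfl | hpos
  · have : Subsingleton V := Module.finrank_zero_iff.1 hn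
    rw [sumEndMob_of_subsingleton, mob_top_of_subsingleton, Nat.card_unique]
    simp
  have hnt : Nontrivial V := Module.nontrivial_of_finrank_pos (R := E) (hn ▸ hpos)
  -- For each f the Möbius numbers of all f-invariant subspaces sum to zero; sum this over f and
  -- exchange the sums.
  have h1 : ∑ W : Submodule E V, (Nat.card E : ℤ) ^ ((n - Module.finrank E W) * n) *
      sumEndMob E W = 0 := by
    have : ∀ f : Module.End E V, ∑ W : Submodule E V,
        (if h : ∀ _ : Unit, W ≤ W.comap f then mob (⟨W, h⟩ : InvSub fun _ : Unit => f) else 0)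
          = 0 := by
      intro f
      have h := sum_mob (⊤ : InvSub fun _ : Unit => f)
      rw [if_neg (fun h => top_ne_bot (congrArg Subtype.val h : (⊤ : Submodule E V) = ⊥))] at h
      rw [Finset.sum_dite, Finset.sum_const_zero, add_zero]
      rw [← h, Finset.filter_true_of_mem fun _ _ => le_top]
      refine Finset.sum_bij (fun W _ => ⟨W.1, (mem_filter.1 W.2).2⟩) (by simp) ?_ ?_ ?_
      · intro a _ b _ hab
        exact Subtype.ext (Subtype.mk.inj hab)
      · intro b _
        exact ⟨⟨b.1, by simpa using b.2⟩, by simp, rfl⟩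
      · intro a _
        rfl
    have h := Finset.sum_eq_zero fun f (_ : f ∈ (univ : Finset (Module.End E V))) => this f
    rw [Finset.sum_comm] at h
    simp_rw [sum_end_invMob_restrict, hn] at h
    exact h
  have h2 : ∑ W : Submodule E V, (Nat.card E : ℤ) ^ ((n - Module.finrank E W) * n) *
      (Nat.card W * mob (⊤ : Submodule E W)) = 0 := by
    -- A target of dimension n - 1 admits no injection from V. Multiplying by |E|^n gives the right
    -- exponents: with d = dim W, (n - d)(n - 1) + n = (n - d)n + d.
    have h := sum_mob_mul_card_le_ker (R := E) V (Fin (n - 1) → E)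
    have hno : Nat.card {g : V →ₗ[E] (Fin (n - 1) → E) // Function.Injective g} = 0 := by
      have : IsEmpty {g : V →ₗ[E] (Fin (n - 1) → E) // Function.Injective g} := by
        refine ⟨fun g => ?_⟩
        have := LinearMap.finrank_le_finrank_of_injective g.2
        rw [Module.finrank_fin_fun] at this
        omega
      exact Nat.card_of_isEmpty
    rw [hno] at h
    simp_rw [card_le_ker, Module.finrank_fin_fun] at h
    have h := congrArg (fun z : ℤ => (Nat.card E : ℤ) ^ n * z) h
    simp only [Finset.mul_sum, Nat.cast_zero, mul_zero, Nat.cast_pow] at h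
    rw [← h]
    refine Finset.sum_congr rfl fun W _ => ?_
    rw [← mob_submodule_eq, Module.natCard_eq_pow_finrank (K := E) (V := W), hn]
    have hle : Module.finrank E W ≤ n := hn ▸ Submodule.finrank_le W
    obtain ⟨d, hd⟩ := Nat.exists_eq_add_of_le hle
    obtain ⟨m, rfl⟩ : ∃ m, n = m + 1 := ⟨n - 1, by omega⟩
    have e1 : m + 1 - Module.finrank E W = d := by omega
    rw [e1, Nat.add_sub_cancel, mul_add, mul_one, pow_add, hd, pow_add]
    push_cast
    ring
  have h3 := sub_eq_zero.2 (h1.trans h2.symm)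
  rw [← Finset.sum_sub_distrib] at h3
  rw [Finset.sum_eq_single ⊤] at h3
  · rw [finrank_top, hn, Nat.sub_self, zero_mul, pow_zero, one_mul, one_mul, sub_eq_zero] at h3
    rw [← sumEndMob_congr (Submodule.topEquiv (R := E) (M := V)), h3,
      mob_submodule_congr (Submodule.topEquiv (R := E) (M := V)),
      Nat.card_congr (Submodule.topEquiv (R := E) (M := V)).toEquiv]
  · intro W _ hW
    have hlt : Module.finrank E W < n := hn ▸ Submodule.finrank_lt hW
    rw [ih _ hlt W rfl, sub_self]
  · simp

end Field

/-- In a finite monoid, a suitable power, uniform in the element, is idempotent. -/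
theorem isIdempotentElem_pow_factorial_card {M : Type*} [Monoid M] [Finite M] (x : M) :
    IsIdempotentElem (x ^ (Nat.card M).factorial) := by
  obtain ⟨i, j, hij, hlt⟩ : ∃ i j : Fin (Nat.card M + 1), x ^ (i : ℕ) = x ^ (j : ℕ) ∧ i < j := by
    obtain ⟨i, j, hne, h⟩ := Fintype.exists_ne_map_eq_of_card_lt
      (fun i : Fin (Nat.card M + 1) => x ^ (i : ℕ)) (by simp [Nat.card_eq_fintype_card])
    rcases lt_or_gt_of_ne hne with h' | h'
    · exact ⟨i, j, h, h'⟩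
    · exact ⟨j, i, h.symm, h'⟩
  have hlt' : (i : ℕ) < j := hlt
  obtain ⟨p, hp⟩ := Nat.exists_eq_add_of_lt hlt'
  have hstep : ∀ n, (i : ℕ) ≤ n → x ^ (n + (p + 1)) = x ^ n := by
    intro n hn
    obtain ⟨d, rfl⟩ := Nat.exists_eq_add_of_le hn
    rw [show (i : ℕ) + d + (p + 1) = j + d by omega, pow_add, ← hij, ← pow_add]
  have hstep' : ∀ k n, (i : ℕ) ≤ n → x ^ (n + k * (p + 1)) = x ^ n := by
    intro k
    induction k with
    | zero => simp
    | succ k ih =>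
      intro n hn
      rw [Nat.succ_mul, ← Nat.add_assoc, hstep _ (by omega), ih n hn]
  have hj := j.2
  -- The powers of x have period p + 1 from exponent i on; the factorial is a multiple of the period
  -- and is at least i, so doubling it does not change the power.
  obtain ⟨k, hk⟩ : p + 1 ∣ (Nat.card M).factorial := Nat.dvd_factorial (by omega) (by omega)
  have hle : (i : ℕ) ≤ (Nat.card M).factorial := le_trans (by omega) (Nat.self_le_factorial _)
  have h := hstep' k _ hle
  rw [IsIdempotentElem, ← pow_add]
  rwa [Nat.mul_comm, ← hk] at h

section Prod

variable {R U₀ U₁ : Type*} [Ring R] [AddCommGroup U₀] [Module R U₀] [AddCommGroup U₁] [Module R U₁]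

theorem eq_prodMap_of_commute {f : Module.End R (U₀ × U₁)}
    (hf : Commute f (LinearMap.prodMap (0 : Module.End R U₀) (1 : Module.End R U₁))) :
    f = LinearMap.prodMap (LinearMap.fst R U₀ U₁ ∘ₗ f ∘ₗ LinearMap.inl R U₀ U₁)
      (LinearMap.snd R U₀ U₁ ∘ₗ f ∘ₗ LinearMap.inr R U₀ U₁) := by
  have h : ∀ u v, f (0, v) = (0, (f (u, v)).2) := fun u v => by
    simpa using LinearMap.congr_fun hf (u, v)
  have h00 : f (0, 0) = 0 := map_zero f
  ext u
  · simp
  · have := h u 0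
    rw [Prod.mk_zero_zero, map_zero] at this
    simpa [h00] using (congrArg Prod.snd this).symm
  · have := h 0 u
    simpa [h00] using congrArg Prod.fst this
  · simp

theorem prodMap_injective {f₀ g₀ : Module.End R U₀} {f₁ g₁ : Module.End R U₁}
    (h : LinearMap.prodMap f₀ f₁ = LinearMap.prodMap g₀ g₁) : f₀ = g₀ ∧ f₁ = g₁ := by
  constructor
  · ext u
    simpa using congrArg Prod.fst (LinearMap.congr_fun h (u, 0))
  · ext u
    simpa using congrArg Prod.snd (LinearMap.congr_fun h (0, u))

variable [Finite U₀] [Finite U₁]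

/-- The scalar b acts as the projection to U₁, so every submodule of the product splits. -/
theorem mob_top_prod (b : R) (h₀ : ∀ u : U₀, b • u = 0) (h₁ : ∀ u : U₁, b • u = u) :
    mob (⊤ : Submodule R (U₀ × U₁)) = mob (⊤ : Submodule R U₀) * mob (⊤ : Submodule R U₁) := by
  rw [← invMob_zero (ι := Unit), ← invMob_zero (ι := Unit), ← invMob_zero (ι := Unit),
    ← invMob_prodMap]
  · simp
  · intro W u hu
    simpa [h₀, h₁, Prod.smul_def] using W.1.smul_mem b hu

end Prod

/-! ### Endomorphisms of finite modules over a commutative ring. -/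

section CommRing

variable {A : Type*} [CommRing A]

/-- Endomorphisms commute with the projection given by b, hence are block diagonal, and submodules
split as well. -/
theorem sumEndMob_prod {U₀ U₁ : Type*} [AddCommGroup U₀] [Module A U₀] [AddCommGroup U₁]
    [Module A U₁] [Finite U₀] [Finite U₁] (b : A) (h₀ : ∀ u : U₀, b • u = 0)
    (h₁ : ∀ u : U₁, b • u = u) :
    sumEndMob A (U₀ × U₁) = sumEndMob A U₀ * sumEndMob A U₁ := by
  have hb : LinearMap.prodMap (0 : Module.End A U₀) (1 : Module.End A U₁) =
      algebraMap A (Module.End A (U₀ × U₁)) b := by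
    ext u <;> simp [h₀, h₁]
  rw [sumEndMob, sumEndMob, sumEndMob, Finset.sum_mul_sum, ← Fintype.sum_prod_type']
  symm
  refine Fintype.sum_bijective
    (fun f : Module.End A U₀ × Module.End A U₁ => LinearMap.prodMap f.1 f.2) ⟨?_, ?_⟩ _ _ ?_
  · intro f g h
    exact Prod.ext (prodMap_injective h).1 (prodMap_injective h).2
  · intro f
    exact ⟨(_, _), (eq_prodMap_of_commute (hb ▸ (Algebra.commutes b f).symm)).symm⟩
  · intro f
    rw [← invMob_prodMap]
    intro W u hu
    simpa [h₀, h₁, Prod.smul_def] using W.1.smul_mem b hu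

/-- Every scalar acts as zero or invertibly, so A / Ann V is a field; over it V has the same
submodules and the same endomorphisms, which reduces to `sumEndMob_eq_of_field`. -/
theorem sumEndMob_eq_of_trichotomy {V : Type*} [AddCommGroup V] [Module A V] [Finite V]
    [Nontrivial V] (h : ∀ b : A, algebraMap A (Module.End A V) b = 0 ∨
      ∃ m : ℕ, algebraMap A (Module.End A V) b ^ (m + 1) = 1) :
    sumEndMob A V = Nat.card V * mob (⊤ : Submodule A V) := by
  have hmk : ∀ b : A, Ideal.Quotient.mk (Module.annihilator A V) b = 0 ↔
      algebraMap A (Module.End A V) b = 0 := by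
    intro b
    rw [Ideal.Quotient.eq_zero_iff_mem, Module.mem_annihilator, LinearMap.ext_iff]
    simp
  have hfield : IsField (A ⧸ Module.annihilator A V) := by
    refine ⟨⟨0, 1, fun h01 => ?_⟩, mul_comm, ?_⟩
    · have := (hmk 1).1 (by rw [map_one, ← h01])
      rw [map_one] at this
      exact one_ne_zero this
    · intro x hx
      obtain ⟨b, rfl⟩ := Ideal.Quotient.mk_surjective x
      rcases h b with hb | ⟨m, hm⟩
      · exact absurd ((hmk b).2 hb) hx
      · refine ⟨Ideal.Quotient.mk _ (b ^ m), ?_⟩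
        rw [← map_mul, ← sub_eq_zero, ← map_one (Ideal.Quotient.mk _), ← map_sub, hmk, map_sub,
          ← pow_succ', map_pow, hm, map_one, sub_self]
  let := hfield.toField
  let : Module (A ⧸ Module.annihilator A V) V := Module.quotientAnnihilator
  have hsmul : ∀ (b : A) (v : V), Ideal.Quotient.mk (Module.annihilator A V) b • v = b • v :=
    fun b v => rfl
  have : IsScalarTower A (A ⧸ Module.annihilator A V) V := by
    refine ⟨fun a x v => ?_⟩
    obtain ⟨b, rfl⟩ := Ideal.Quotient.mk_surjective x
    rw [hsmul, ← mul_smul, ← hsmul, map_mul]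
    rfl
  -- The field embeds in V by acting on a nonzero vector.
  have : Finite (A ⧸ Module.annihilator A V) := by
    obtain ⟨v, hv⟩ := exists_ne (0 : V)
    refine Finite.of_injective (fun x : A ⧸ Module.annihilator A V => x • v) ?_
    exact smul_left_injective _ hv
  have hsub : ∀ f : Module.End A V, invMob (fun _ : Unit => f) = invMob fun _ : Unit =>
      LinearMap.extendScalarsOfSurjective (S := A ⧸ Module.annihilator A V)
        Ideal.Quotient.mk_surjective f := by
    intro f
    refine invMob_congr_coe (fun W => ⟨⟨⟨W.1.toAddSubmonoid, ?_⟩, W.2⟩, rfl⟩)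
      (fun W => ⟨⟨W.1.restrictScalars A, W.2⟩, rfl⟩)
    intro x v hv
    obtain ⟨b, rfl⟩ := Ideal.Quotient.mk_surjective x
    exact W.1.smul_mem b hv
  have hsum : sumEndMob A V = sumEndMob (A ⧸ Module.annihilator A V) V := by
    refine Fintype.sum_equiv (LinearMap.extendScalarsOfSurjectiveEquiv
      (Ideal.Quotient.mk_surjective (I := Module.annihilator A V))).toEquiv _ _ fun f => ?_
    exact hsub f
  have htop : mob (⊤ : Submodule A V) = mob (⊤ : Submodule (A ⧸ Module.annihilator A V) V) := by
    rw [← invMob_zero (ι := Unit), ← invMob_zero (ι := Unit), hsub]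
    rfl
  rw [hsum, htop]
  exact sumEndMob_eq_of_field _ V rfl

/-- Induction on |V|. A scalar acting as a nonzero nilpotent makes both sides vanish, and one acting
as a nontrivial idempotent splits V into smaller modules. Otherwise V is a vector space over a
quotient field of A. -/
theorem sumEndMob_eq_aux.{u, v} {A : Type u} [CommRing A] (n : ℕ) :
    ∀ (V : Type v) [AddCommGroup V] [Module A V] [Finite V], Nat.card V = n →
      sumEndMob A V = Nat.card V * mob (⊤ : Submodule A V) := by
  induction n using Nat.strong_induction_on with
  | _ n ih =>
  intro V _ _ _ hn
  rcases subsingleton_or_nontrivial V with hV | hV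
  · rw [sumEndMob_of_subsingleton, mob_top_of_subsingleton, Nat.card_unique]
    simp
  by_cases hnil : ∃ b : A, IsNilpotent (algebraMap A (Module.End A V) b) ∧
      algebraMap A (Module.End A V) b ≠ 0
  · obtain ⟨b, hb, hb0⟩ := hnil
    have hzero : ∀ f : Module.End A V, invMob (fun _ : Unit => f) = 0 := fun f =>
      invMob_eq_zero_of_isNilpotent _ _ hb hb0 (fun _ => Algebra.commutes b f)
        fun W v hv => W.1.smul_mem b hv
    rw [sumEndMob, Finset.sum_eq_zero fun f _ => hzero f, ← invMob_zero (ι := Unit), hzero,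
      mul_zero]
  by_cases hidem : ∃ b : A, IsIdempotentElem (algebraMap A (Module.End A V) b) ∧
      algebraMap A (Module.End A V) b ≠ 0 ∧ algebraMap A (Module.End A V) b ≠ 1
  · obtain ⟨b, hb, hb0, hb1⟩ := hidem
    have hcompl := LinearMap.IsIdempotentElem.isCompl hb
    set p := algebraMap A (Module.End A V) b with hp
    have e := Submodule.prodEquivOfIsCompl _ _ hcompl.symm
    have h₀ : ∀ u : LinearMap.ker p, b • u = 0 := fun u => Subtype.ext u.2
    have h₁ : ∀ u : LinearMap.range p, b • u = u := by
      rintro ⟨_, v, rfl⟩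
      exact Subtype.ext (LinearMap.congr_fun hb v)
    have c₀ : Nat.card (LinearMap.ker p) < n := by
      obtain ⟨v, hv⟩ : ∃ v, p v ≠ 0 := by
        by_contra! h
        exact hb0 (LinearMap.ext h)
      exact hn ▸ Finite.card_subtype_lt (p := fun v => v ∈ LinearMap.ker p) hv
    have c₁ : Nat.card (LinearMap.range p) < n := by
      obtain ⟨v, hv⟩ : ∃ v, p v ≠ v := by
        by_contra! h
        exact hb1 (LinearMap.ext h)
      refine hn ▸ Finite.card_subtype_lt (p := fun v => v ∈ LinearMap.range p) (x := v) ?_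
      rintro ⟨w, rfl⟩
      exact hv (LinearMap.congr_fun hb w)
    rw [← sumEndMob_congr e, ← mob_submodule_congr e, ← Nat.card_congr e.toEquiv,
      sumEndMob_prod b h₀ h₁, mob_top_prod b h₀ h₁, ih _ c₀ _ rfl, ih _ c₁ _ rfl, Nat.card_prod]
    push_cast
    ring
  push Not at hnil hidem
  refine sumEndMob_eq_of_trichotomy fun b => ?_
  obtain ⟨m, hm⟩ : ∃ m, (Nat.card (Module.End A V)).factorial = m + 1 :=
    Nat.exists_eq_succ_of_ne_zero (Nat.factorial_ne_zero _)
  -- Some positive power of the action of b is idempotent, hence 0 or 1; if it is 0, then b acts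
  -- nilpotently, hence as 0.
  have hid := isIdempotentElem_pow_factorial_card (algebraMap A (Module.End A V) b)
  rw [hm, ← map_pow] at hid
  by_cases h0 : algebraMap A (Module.End A V) (b ^ (m + 1)) = 0
  · left
    exact hnil b ⟨m + 1, by rw [← map_pow, h0]⟩
  · right
    exact ⟨m, by rw [← map_pow, hidem _ hid h0]⟩

/-- The sum of the Möbius numbers of the lattices of `f`-invariant submodules over all
endomorphisms `f` of a finite module. -/
theorem sumEndMob_eq (V : Type*) [AddCommGroup V] [Module A V] [Finite V] :
    sumEndMob A V = Nat.card V * mob (⊤ : Submodule A V) :=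
  sumEndMob_eq_aux _ V rfl

end CommRing

/-! ### Sums over commuting tuples -/

section Tuples

variable (K V : Type*) [Field K] [AddCommGroup V] [Module K V] [Finite V]

/-- The commuting `r`-tuples of automorphisms of `V`. -/
noncomputable def commTuples (r : ℕ) : Finset (Fin r → Module.End K V) :=
  univ.filter fun Y => (∀ i, IsUnit (Y i)) ∧ ∀ i j, Commute (Y i) (Y j)

/-- The sum of the Möbius numbers over the commuting `r`-tuples of automorphisms. -/
noncomputable def tupleSum (r : ℕ) : ℤ := ∑ Y ∈ commTuples K V r, invMob Y

/-- The commuting `(r + 1)`-tuples of endomorphisms, the first one satisfying `P` and the others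
invertible. -/
noncomputable def headTuples (P : Module.End K V → Prop) (r : ℕ) :
    Finset (Fin (r + 1) → Module.End K V) :=
  univ.filter fun Y => P (Y 0) ∧ (∀ i : Fin r, IsUnit (Y i.succ)) ∧ ∀ i j, Commute (Y i) (Y j)

variable {K V}

theorem mem_commTuples {r : ℕ} {Y : Fin r → Module.End K V} :
    Y ∈ commTuples K V r ↔ (∀ i, IsUnit (Y i)) ∧ ∀ i j, Commute (Y i) (Y j) := by
  simp [commTuples]

theorem mem_headTuples {P : Module.End K V → Prop} {r : ℕ} {Y : Fin (r + 1) → Module.End K V} :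
    Y ∈ headTuples K V P r ↔
      P (Y 0) ∧ (∀ i : Fin r, IsUnit (Y i.succ)) ∧ ∀ i j, Commute (Y i) (Y j) := by
  simp [headTuples]

theorem headTuples_isUnit (r : ℕ) : headTuples K V IsUnit r = commTuples K V (r + 1) := by
  ext Y
  rw [mem_headTuples, mem_commTuples, Fin.forall_fin_succ (P := fun i => IsUnit (Y i)), and_assoc]

theorem sum_headTuples (P : Module.End K V → Prop) (r : ℕ) :
    ∑ Y ∈ headTuples K V P r, invMob Y = ∑ Y ∈ commTuples K V r,
      ∑ f : Module.End K V with P f ∧ ∀ i, Commute f (Y i),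
        invMob (Fin.cons f Y : Fin (r + 1) → Module.End K V) := by
  rw [Finset.sum_sigma']
  symm
  refine Finset.sum_bij (fun s _ => Fin.cons s.2 s.1) ?_ ?_ ?_ ?_
  · rintro ⟨Y, f⟩ h
    simp only [mem_sigma, mem_filter, mem_univ, true_and, mem_commTuples] at h
    rw [mem_headTuples]
    refine ⟨h.2.1, h.1.1, ?_⟩
    rw [Fin.forall_fin_succ]
    refine ⟨?_, fun i => ?_⟩
    · rw [Fin.forall_fin_succ]
      exact ⟨Commute.refl _, fun i => by simpa using h.2.2 i⟩
    · rw [Fin.forall_fin_succ]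
      exact ⟨by simpa using (h.2.2 i).symm, fun j => by simpa using h.1.2 i j⟩
  · rintro ⟨Y, f⟩ _ ⟨Y', f'⟩ _ h
    have := Fin.cons_injective2 (α := fun _ => Module.End K V) h
    exact Sigma.ext this.2 (heq_of_eq this.1)
  · intro Y hY
    rw [mem_headTuples] at hY
    refine ⟨⟨Fin.tail Y, Y 0⟩, ?_, Fin.cons_self_tail Y⟩
    simp only [mem_sigma, mem_filter, mem_univ, true_and, mem_commTuples]
    exact ⟨⟨hY.2.1, fun i j => hY.2.2 _ _⟩, hY.1, fun i => hY.2.2 _ _⟩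
  · intro s _
    rfl

/-- A nonzero nilpotent first entry makes the Möbius number vanish, and the entry 0 imposes no
condition on subspaces. -/
theorem sum_headTuples_isNilpotent (r : ℕ) :
    ∑ Y ∈ headTuples K V IsNilpotent r, invMob Y = tupleSum K V r := by
  rw [sum_headTuples, tupleSum]
  refine Finset.sum_congr rfl fun Y _ => ?_
  rw [Finset.sum_eq_single 0]
  · refine invMob_congr_coe (fun W => ⟨⟨W.1, fun i => W.2 i.succ⟩, rfl⟩)
      (fun W => ⟨⟨W.1, fun i => ?_⟩, rfl⟩)
    refine Fin.cases ?_ (fun i => ?_) i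
    · intro v _
      simp
    · exact W.2 i
  · intro f hf hne
    simp only [mem_filter, mem_univ, true_and] at hf
    refine invMob_eq_zero_of_isNilpotent _ f hf.1 hne (fun i => ?_) fun W => W.2 0
    refine Fin.cases ?_ (fun i => ?_) i
    · exact Commute.refl _
    · exact hf.2 i
  · intro h
    exact absurd (by simp) h

/-- Over the commutative algebra A = K[Y], submodules are the Y-invariant subspaces and
endomorphisms are the maps commuting with Y, so this is `sumEndMob_eq` for A. -/
theorem sum_commute_invMob_cons {r : ℕ} (Y : Fin r → Module.End K V)
    (hY : ∀ i j, Commute (Y i) (Y j)) :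
    ∑ f : Module.End K V with ∀ i, Commute f (Y i),
        invMob (Fin.cons f Y : Fin (r + 1) → Module.End K V) = Nat.card V * invMob Y := by
  let A := Algebra.adjoin K (Set.range Y)
  have hcomm : IsMulCommutative A := Algebra.isMulCommutative_adjoin K (by
    rintro _ ⟨i, rfl⟩ _ ⟨j, rfl⟩
    exact hY i j)
  let _ : CommRing A := { A.toRing with mul_comm := hcomm.is_comm.comm }
  have hmem : ∀ i, Y i ∈ A := fun i => Algebra.subset_adjoin ⟨i, rfl⟩
  have hstab : ∀ W : Submodule K V, (∀ i, W ≤ W.comap (Y i)) → ∀ a ∈ A, ∀ w ∈ W, a w ∈ W := by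
    intro W hW a ha
    induction ha using Algebra.adjoin_induction with
    | mem x hx =>
      obtain ⟨i, rfl⟩ := hx
      exact fun w hw => hW i hw
    | algebraMap c => exact fun w hw => W.smul_mem c hw
    | add x y _ _ hx hy => exact fun w hw => W.add_mem (hx w hw) (hy w hw)
    | mul x y _ _ hx hy => exact fun w hw => hx _ (hy w hw)
  have key := sumEndMob_eq (A := A) V
  have htop : mob (⊤ : Submodule A V) = invMob Y := by
    rw [← invMob_zero (ι := Unit)]
    refine invMob_congr_coe
      (fun W => ⟨⟨W.1.restrictScalars K, fun i v hv => W.1.smul_mem ⟨Y i, hmem i⟩ hv⟩, rfl⟩)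
      (fun W => ⟨⟨⟨W.1.toAddSubmonoid, fun a v hv => hstab W.1 W.2 a.1 a.2 v hv⟩,
        fun _ v _ => by simp⟩, rfl⟩)
  rw [← htop, ← key, sumEndMob]
  symm
  refine Finset.sum_bij (fun f _ => f.restrictScalars K) ?_ ?_ ?_ ?_
  · intro f _
    simp only [mem_filter, mem_univ, true_and]
    intro i
    ext v
    exact f.map_smul (⟨Y i, hmem i⟩ : A) v
  · intro f _ g _ h
    exact LinearMap.restrictScalars_injective K h
  · intro f hf
    simp only [mem_filter, mem_univ, true_and] at hf
    have hfA : ∀ a ∈ A, Commute f a := by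
      intro a ha
      induction ha using Algebra.adjoin_induction with
      | mem x hx =>
        obtain ⟨i, rfl⟩ := hx
        exact hf i
      | algebraMap c => exact Algebra.commutes' c f |>.symm
      | add x y _ _ hx hy => exact hx.add_right hy
      | mul x y _ _ hx hy => exact hx.mul_right hy
    exact ⟨⟨f.toAddHom, fun a v => LinearMap.congr_fun (hfA a.1 a.2) v⟩, mem_univ _, rfl⟩
  · intro f _
    refine invMob_congr_coe
      (fun W => ⟨⟨W.1.restrictScalars K, fun i => ?_⟩, rfl⟩)
      (fun W => ⟨⟨⟨W.1.toAddSubmonoid,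
        fun a v hv => hstab W.1 (fun i => W.2 i.succ) a.1 a.2 v hv⟩, fun _ => W.2 0⟩, rfl⟩)
    refine Fin.cases ?_ (fun i => ?_) i
    · exact W.2 ()
    · exact fun v hv => W.1.smul_mem (⟨Y i, hmem i⟩ : A) hv

theorem sum_headTuples_true (r : ℕ) :
    ∑ Y ∈ headTuples K V (fun _ => True) r, invMob Y = Nat.card V * tupleSum K V r := by
  rw [sum_headTuples, tupleSum, Finset.mul_sum]
  refine Finset.sum_congr rfl fun Y hY => ?_
  simp only [true_and]
  exact sum_commute_invMob_cons Y (mem_commTuples.1 hY).2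

end Tuples

/-! ### Fitting decompositions -/

/-- The idempotent power of an element of a finite monoid. -/
noncomputable def idemPow {M : Type*} [Monoid M] (x : M) : M := x ^ (Nat.card M).factorial

/-- Among the positive powers of x only one is idempotent, so the chosen exponent is immaterial. -/
theorem idemPow_eq {M : Type*} [Monoid M] [Finite M] {x p : M} (hp : IsIdempotentElem p) {n : ℕ}
    (h : p = x ^ (n + 1)) : idemPow x = p := by
  obtain ⟨m, hm⟩ : ∃ m, (Nat.card M).factorial = m + 1 :=
    Nat.exists_eq_succ_of_ne_zero (Nat.factorial_ne_zero _)
  have hx := isIdempotentElem_pow_factorial_card x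
  rw [idemPow]
  rw [hm] at hx ⊢
  calc x ^ (m + 1) = (x ^ (m + 1)) ^ (n + 1) := (hx.pow_succ_eq n).symm
    _ = p ^ (m + 1) := by rw [h, ← pow_mul, ← pow_mul, Nat.mul_comm]
    _ = p := hp.pow_succ_eq m

section Fitting

variable {K V U₀ U₁ : Type*} [Field K] [AddCommGroup V] [Module K V]
  [AddCommGroup U₀] [Module K U₀] [AddCommGroup U₁] [Module K U₁]

/-- Block diagonal endomorphisms with respect to a decomposition of `V`. -/
noncomputable def blockHom (e : (U₀ × U₁) ≃ₗ[K] V) :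
    Module.End K U₀ × Module.End K U₁ →+* Module.End K V :=
  e.conjRingEquiv.toRingHom.comp (LinearMap.prodMapRingHom K U₀ U₁)

theorem blockHom_refl_apply (x : Module.End K U₀ × Module.End K U₁) (u : U₀ × U₁) :
    blockHom (LinearEquiv.refl K (U₀ × U₁)) x u = (x.1 u.1, x.2 u.2) := rfl

@[simp] theorem blockHom_apply (e : (U₀ × U₁) ≃ₗ[K] V)
    (x : Module.End K U₀ × Module.End K U₁) (u : U₀ × U₁) :
    blockHom e x (e u) = e (x.1 u.1, x.2 u.2) := by
  simp [blockHom]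

theorem blockHom_injective (e : (U₀ × U₁) ≃ₗ[K] V) : Function.Injective (blockHom e) := by
  intro x y h
  have h' := prodMap_injective (e.conjRingEquiv.injective h)
  exact Prod.ext h'.1 h'.2

theorem isUnit_blockHom_iff (e : (U₀ × U₁) ≃ₗ[K] V) (x : Module.End K U₀ × Module.End K U₁) :
    IsUnit (blockHom e x) ↔ IsUnit x.1 ∧ IsUnit x.2 := by
  rw [Module.End.isUnit_iff, Module.End.isUnit_iff, Module.End.isUnit_iff, ← Prod.map_bijective,
    ← e.bijective.of_comp_iff]
  have : ⇑(blockHom e x) ∘ e = e ∘ Prod.map x.1 x.2 := by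
    ext u; simp [Prod.map]
  rw [this, e.bijective.of_comp_iff']

theorem commute_blockHom_iff (e : (U₀ × U₁) ≃ₗ[K] V) (x y : Module.End K U₀ × Module.End K U₁) :
    Commute (blockHom e x) (blockHom e y) ↔ Commute x.1 y.1 ∧ Commute x.2 y.2 := by
  rw [commute_map_iff (blockHom_injective e), Prod.commute_iff]

theorem exists_blockHom_eq_of_commute (e : (U₀ × U₁) ≃ₗ[K] V) {f : Module.End K V}
    (hf : Commute f (blockHom e (0, 1))) : ∃ x, blockHom e x = f := by
  have h : Commute (e.conjRingEquiv.symm f)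
      (LinearMap.prodMap (0 : Module.End K U₀) (1 : Module.End K U₁)) := by
    have := hf.map e.conjRingEquiv.symm
    simpa [blockHom] using this
  have h' := eq_prodMap_of_commute h
  set f₀ := LinearMap.fst K U₀ U₁ ∘ₗ e.conjRingEquiv.symm f ∘ₗ LinearMap.inl K U₀ U₁
  set f₁ := LinearMap.snd K U₀ U₁ ∘ₗ e.conjRingEquiv.symm f ∘ₗ LinearMap.inr K U₀ U₁
  refine ⟨(f₀, f₁), ?_⟩
  rw [← e.conjRingEquiv.apply_symm_apply f, h']
  rfl

theorem isIdempotentElem_blockHom (e : (U₀ × U₁) ≃ₗ[K] V) :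
    IsIdempotentElem (blockHom e (0, 1)) := by
  rw [IsIdempotentElem, ← map_mul]
  simp

theorem pow_apply_mem {f : Module.End K V} {W : Submodule K V} (h : W ≤ W.comap f) (n : ℕ) :
    ∀ v ∈ W, (f ^ n) v ∈ W := by
  induction n with
  | zero => simp
  | succ n ih =>
    intro v hv
    rw [pow_succ', Module.End.mul_apply]
    exact h (ih v hv)

theorem isNilpotent_isUnit_of_idemPow (e : (U₀ × U₁) ≃ₗ[K] V)
    {x : Module.End K U₀ × Module.End K U₁} (h : idemPow (blockHom e x) = blockHom e (0, 1)) :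
    IsNilpotent x.1 ∧ IsUnit x.2 := by
  rw [idemPow, ← map_pow] at h
  have h := blockHom_injective e h
  exact ⟨⟨_, congrArg Prod.fst h⟩,
    IsUnit.of_pow_eq_one (congrArg Prod.snd h) (Nat.factorial_ne_zero _)⟩

theorem finrank_ker_blockHom (e : (U₀ × U₁) ≃ₗ[K] V) :
    Module.finrank K (LinearMap.ker (blockHom e (0, 1))) = Module.finrank K U₀ := by
  refine (LinearEquiv.finrank_eq (LinearEquiv.ofBijective
    (LinearMap.codRestrict _ (e.toLinearMap ∘ₗ LinearMap.inl K U₀ U₁) fun u => ?_) ⟨?_, ?_⟩)).symm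
  · simp
  · intro u v h
    have h : e (u, 0) = e (v, 0) := congrArg Subtype.val h
    simpa using h
  · rintro ⟨v, hv⟩
    obtain ⟨⟨u₀, u₁⟩, rfl⟩ := e.surjective v
    simp only [LinearMap.mem_ker, blockHom_apply, LinearMap.zero_apply, Module.End.one_apply,
      EmbeddingLike.map_eq_zero_iff, Prod.mk_eq_zero, true_and] at hv
    exact ⟨u₀, Subtype.ext (congrArg (fun w => e (u₀, w)) hv.symm)⟩

/-- Two identifications with the same projection differ by a block diagonal automorphism of U₀ × U₁.
-/
theorem card_blockHom_eq (e₀ : (U₀ × U₁) ≃ₗ[K] V) :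
    Nat.card {e : (U₀ × U₁) ≃ₗ[K] V // blockHom e (0, 1) = blockHom e₀ (0, 1)} =
      Nat.card (U₀ ≃ₗ[K] U₀) * Nat.card (U₁ ≃ₗ[K] U₁) := by
  rw [← Nat.card_prod]
  symm
  refine Nat.card_congr (Equiv.ofBijective
    (fun a : (U₀ ≃ₗ[K] U₀) × (U₁ ≃ₗ[K] U₁) => ⟨(a.1.prodCongr a.2).trans e₀, ?_⟩) ⟨?_, ?_⟩)
  · refine LinearMap.ext fun v => ?_
    obtain ⟨u, rfl⟩ := ((a.1.prodCongr a.2).trans e₀).surjective v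
    rw [blockHom_apply]
    simp
  · intro a b h
    have h : ∀ u : U₀ × U₁, (a.1 u.1, a.2 u.2) = (b.1 u.1, b.2 u.2) := fun u =>
      e₀.injective (LinearEquiv.congr_fun (congrArg Subtype.val h) u)
    refine Prod.ext (LinearEquiv.ext fun u => ?_) (LinearEquiv.ext fun u => ?_)
    · exact congrArg Prod.fst (h (u, 0))
    · exact congrArg Prod.snd (h (0, u))
  · rintro ⟨e, he⟩
    have hcomm : Commute ((e.trans e₀.symm : (U₀ × U₁) ≃ₗ[K] (U₀ × U₁)) : Module.End K (U₀ × U₁))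
        (blockHom (LinearEquiv.refl K (U₀ × U₁)) (0, 1)) := by
      refine LinearMap.ext fun u => e₀.injective ?_
      have h1 := LinearMap.congr_fun he (e u)
      rw [blockHom_apply, ← e₀.apply_symm_apply (e u), blockHom_apply] at h1
      simp only [Module.End.mul_apply, LinearEquiv.coe_coe, LinearEquiv.trans_apply,
        blockHom_refl_apply, LinearEquiv.apply_symm_apply] at h1 ⊢
      exact h1
    obtain ⟨x, hx⟩ := exists_blockHom_eq_of_commute _ hcomm
    have hu := (isUnit_blockHom_iff (LinearEquiv.refl K (U₀ × U₁)) x).1 (by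
      rw [hx, Module.End.isUnit_iff]
      exact (e.trans e₀.symm).bijective)
    rw [Module.End.isUnit_iff, Module.End.isUnit_iff] at hu
    refine ⟨(LinearEquiv.ofBijective x.1 hu.1, LinearEquiv.ofBijective x.2 hu.2),
      Subtype.ext (LinearEquiv.ext fun u => ?_)⟩
    have h3 := LinearMap.congr_fun hx u
    rw [blockHom_refl_apply] at h3
    simp only [LinearEquiv.coe_coe, LinearEquiv.trans_apply] at h3
    have h5 := congrArg e₀ h3
    rw [LinearEquiv.apply_symm_apply] at h5
    exact h5

variable [Finite V] [Finite U₁]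

theorem idemPow_blockHom (e : (U₀ × U₁) ≃ₗ[K] V) {x : Module.End K U₀ × Module.End K U₁}
    (h₀ : IsNilpotent x.1) (h₁ : IsUnit x.2) : idemPow (blockHom e x) = blockHom e (0, 1) := by
  obtain ⟨a, ha⟩ := h₀
  obtain ⟨u, hu⟩ := h₁
  obtain ⟨b, hb⟩ : ∃ b, orderOf u = b + 1 :=
    Nat.exists_eq_succ_of_ne_zero (orderOf_pos u).ne'
  have hu1 : x.2 ^ (b + 1) = 1 := by
    rw [← hu, ← Units.val_pow_eq_pow_val, ← hb, pow_orderOf_eq_one, Units.val_one]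
  -- The exponent n + 1 = (a + 1)(b + 1) is at least a, which kills the nilpotent block, and is a
  -- multiple of the order of the unit block.
  refine idemPow_eq (n := a * (b + 1) + b) (isIdempotentElem_blockHom e) ?_
  rw [← map_pow]
  congr 1
  rw [show a * (b + 1) + b + 1 = (b + 1) * (a + 1) by ring]
  refine Prod.ext ?_ ?_
  · rw [Prod.pow_fst, Nat.mul_comm, pow_mul, pow_succ _ a, ha, zero_mul, zero_pow (by omega)]
  · rw [Prod.pow_snd, pow_mul, hu1, one_pow]

variable [Finite U₀]

theorem invMob_blockHom (e : (U₀ × U₁) ≃ₗ[K] V) {r : ℕ} (Y₀ : Fin (r + 1) → Module.End K U₀)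
    (Y₁ : Fin (r + 1) → Module.End K U₁) (h₀ : IsNilpotent (Y₀ 0)) (h₁ : IsUnit (Y₁ 0)) :
    invMob (fun i => blockHom e (Y₀ i, Y₁ i)) = invMob Y₀ * invMob Y₁ := by
  rw [← invMob_prodMap]
  · refine (invMob_congr e fun i v => ?_).symm
    simp
  · intro W u hu
    -- The projection to U₁ is a power of the first entry, so it preserves every invariant subspace.
    have h := idemPow_blockHom (LinearEquiv.refl K (U₀ × U₁)) (x := (Y₀ 0, Y₁ 0)) h₀ h₁
    have hmem := pow_apply_mem (W.2 0) (Nat.card (Module.End K (U₀ × U₁))).factorial u hu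
    change idemPow (blockHom (LinearEquiv.refl K (U₀ × U₁)) (Y₀ 0, Y₁ 0)) u ∈ W.1 at hmem
    rwa [h, blockHom_refl_apply] at hmem

/-- The tuples with a given Fitting decomposition of the first entry. -/
theorem sum_headTuples_idemPow_eq (e : (U₀ × U₁) ≃ₗ[K] V) (r : ℕ) :
    ∑ Y ∈ headTuples K V (fun _ => True) r with idemPow (Y 0) = blockHom e (0, 1), invMob Y =
      tupleSum K U₀ r * tupleSum K U₁ (r + 1) := by
  rw [← sum_headTuples_isNilpotent, tupleSum, ← headTuples_isUnit, Finset.sum_mul_sum,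
    ← Finset.sum_product']
  symm
  refine Finset.sum_bij (fun y _ i => blockHom e (y.1 i, y.2 i)) ?_ ?_ ?_ ?_
  · rintro ⟨Y₀, Y₁⟩ h
    simp only [mem_product, mem_headTuples] at h
    obtain ⟨⟨h1, h2, h3⟩, h4, h5, h6⟩ := h
    rw [mem_filter, mem_headTuples]
    refine ⟨⟨trivial, fun i => ?_, fun i j => ?_⟩, ?_⟩
    · rw [isUnit_blockHom_iff]
      exact ⟨h2 i, h5 i⟩
    · rw [commute_blockHom_iff]
      exact ⟨h3 i j, h6 i j⟩
    · exact idemPow_blockHom e h1 h4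
  · rintro ⟨Y₀, Y₁⟩ _ ⟨Y₀', Y₁'⟩ _ h
    have h' := fun i => blockHom_injective e (congrFun h i)
    exact Prod.ext (funext fun i => congrArg Prod.fst (h' i))
      (funext fun i => congrArg Prod.snd (h' i))
  · intro Y hY
    rw [mem_filter, mem_headTuples] at hY
    obtain ⟨⟨-, h2, h3⟩, h4⟩ := hY
    -- Every entry commutes with `Y 0`, hence with its power `blockHom e (0, 1)`, and so is block
    -- diagonal.
    have hc : ∀ i, ∃ x, blockHom e x = Y i := by
      intro i
      refine exists_blockHom_eq_of_commute e ?_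
      rw [← h4]
      exact (h3 i 0).pow_right _
    choose x hx using hc
    have h5 := isNilpotent_isUnit_of_idemPow e ((hx 0).symm ▸ h4)
    simp_rw [← hx, isUnit_blockHom_iff] at h2
    simp_rw [← hx, commute_blockHom_iff] at h3
    refine ⟨(fun i => (x i).1, fun i => (x i).2), ?_, ?_⟩
    · simp only [mem_product, mem_headTuples]
      exact ⟨⟨h5.1, fun i => (h2 i).1, fun i j => (h3 i j).1⟩, h5.2, fun i => (h2 i).2,
        fun i j => (h3 i j).2⟩
    · funext i
      exact hx i
  · rintro ⟨Y₀, Y₁⟩ h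
    simp only [mem_product, mem_headTuples] at h
    exact (invMob_blockHom e Y₀ Y₁ h.1.1 h.2.1).symm

theorem exists_blockHom_eq_of_isIdempotentElem {p : Module.End K V} (hp : IsIdempotentElem p)
    (h₀ : Module.finrank K (LinearMap.ker p) = Module.finrank K U₀)
    (h : Module.finrank K U₀ + Module.finrank K U₁ = Module.finrank K V) :
    ∃ e : (U₀ × U₁) ≃ₗ[K] V, blockHom e (0, 1) = p := by
  have h₁ : Module.finrank K (LinearMap.range p) = Module.finrank K U₁ := by
    have := LinearMap.finrank_range_add_finrank_ker p
    omega
  have hcompl := LinearMap.IsIdempotentElem.isCompl hp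
  let e := ((LinearEquiv.ofFinrankEq _ _ h₀.symm).prodCongr
    (LinearEquiv.ofFinrankEq _ _ h₁.symm)).trans (Submodule.prodEquivOfIsCompl _ _ hcompl.symm)
  refine ⟨e, LinearMap.ext fun v => ?_⟩
  obtain ⟨⟨u₀, u₁⟩, rfl⟩ := e.surjective v
  rw [blockHom_apply]
  have e_apply : ∀ u, e u = (LinearEquiv.ofFinrankEq _ _ h₀.symm u.1 : V) +
      (LinearEquiv.ofFinrankEq _ _ h₁.symm u.2 : V) := fun u => rfl
  have hr : ∀ w : LinearMap.range p, p w = w := by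
    rintro ⟨_, w, rfl⟩
    exact LinearMap.congr_fun hp w
  have hk : ∀ w : LinearMap.ker p, p w = 0 := fun w => w.2
  rw [e_apply, e_apply, map_add, hr, hk]
  simp

theorem card_linearEquiv_prod
    (h : Module.finrank K U₀ + Module.finrank K U₁ = Module.finrank K V) :
    Nat.card ((U₀ × U₁) ≃ₗ[K] V) = Nat.card (V ≃ₗ[K] V) := by
  have e : (U₀ × U₁) ≃ₗ[K] V := LinearEquiv.ofFinrankEq _ _ (by rw [Module.finrank_prod, h])
  exact Nat.card_congr
    { toFun := fun f => e.symm.trans f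
      invFun := fun f => e.trans f
      left_inv := fun f => by ext; simp
      right_inv := fun f => by ext; simp }

/-- Double count of pairs (Y, e) in which e realises the Fitting decomposition of `Y 0`: a tuple Y
with nilpotent part of the right dimension has |GL(U₀)| |GL(U₁)| such e, while there are |GL(V)|
choices of e in all. -/
theorem sum_headTuples_finrank_ker_eq
    (h : Module.finrank K U₀ + Module.finrank K U₁ = Module.finrank K V) (r : ℕ) :
    ((Nat.card (U₀ ≃ₗ[K] U₀) * Nat.card (U₁ ≃ₗ[K] U₁) : ℕ) : ℤ) *
      ∑ Y ∈ headTuples K V (fun _ => True) r with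
        Module.finrank K (LinearMap.ker (idemPow (Y 0))) = Module.finrank K U₀, invMob Y =
      Nat.card (V ≃ₗ[K] V) * (tupleSum K U₀ r * tupleSum K U₁ (r + 1)) := by
  have hcount : ∀ Y : Fin (r + 1) → Module.End K V,
      ∑ e : (U₀ × U₁) ≃ₗ[K] V, (if idemPow (Y 0) = blockHom e (0, 1) then invMob Y else 0) =
      if Module.finrank K (LinearMap.ker (idemPow (Y 0))) = Module.finrank K U₀ then
        ((Nat.card (U₀ ≃ₗ[K] U₀) * Nat.card (U₁ ≃ₗ[K] U₁) : ℕ) : ℤ) * invMob Y else 0 := by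
    intro Y
    split_ifs with hY
    · obtain ⟨e₀, he₀⟩ := exists_blockHom_eq_of_isIdempotentElem (U₁ := U₁)
        (isIdempotentElem_pow_factorial_card (Y 0)) hY h
      change _ = idemPow (Y 0) at he₀
      rw [← card_blockHom_eq e₀, ← Finset.sum_filter, Finset.sum_const, nsmul_eq_mul,
        Nat.card_eq_fintype_card, Fintype.card_subtype, he₀]
      simp_rw [eq_comm (a := idemPow (Y 0))]
    · refine Finset.sum_eq_zero fun e _ => if_neg fun he => hY ?_
      rw [he, finrank_ker_blockHom]
  rw [Finset.mul_sum, Finset.sum_filter]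
  simp_rw [← hcount]
  rw [Finset.sum_comm]
  simp_rw [← Finset.sum_filter, sum_headTuples_idemPow_eq]
  rw [Finset.sum_const, nsmul_eq_mul, Finset.card_univ, ← Nat.card_eq_fintype_card,
    card_linearEquiv_prod h]

end Fitting

/-! ### The recursion in r for the coefficients. -/

section Recursion

variable (K : Type*) [Field K] [Finite K]

/-- The coefficients of the generating functions, as weighted sums over commuting tuples. -/
noncomputable def tupleCoeff (r n : ℕ) : ℚ :=
  tupleSum K (Fin n → K) r / Nat.card ((Fin n → K) ≃ₗ[K] (Fin n → K))

/-- Sort the tuples of `sum_headTuples_true` by the dimension `k.2` of the nilpotent part of the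
first entry; dividing by |GL_n| turns the count into a convolution. -/
theorem card_pow_mul_tupleCoeff (r n : ℕ) :
    (Nat.card K : ℚ) ^ n * tupleCoeff K r n =
      ∑ k ∈ antidiagonal n, tupleCoeff K (r + 1) k.1 * tupleCoeff K r k.2 := by
  have hpos : ∀ m : ℕ, (Nat.card ((Fin m → K) ≃ₗ[K] (Fin m → K)) : ℚ) ≠ 0 := fun m =>
    Nat.cast_ne_zero.2 Nat.card_pos.ne'
  have hsum : ((Nat.card K : ℤ) ^ n * tupleSum K (Fin n → K) r : ℤ) =
      ∑ k ∈ antidiagonal n, ∑ Y ∈ headTuples K (Fin n → K) (fun _ => True) r with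
        Module.finrank K (LinearMap.ker (idemPow (Y 0))) = k.2, invMob Y := by
    have h := sum_headTuples_true (K := K) (V := Fin n → K) r
    rw [Module.natCard_eq_pow_finrank (K := K), Module.finrank_fin_fun] at h
    push_cast at h
    rw [← h, ← Finset.Nat.sum_antidiagonal_swap]
    simp only [Prod.snd_swap]
    rw [Finset.Nat.sum_antidiagonal_eq_sum_range_succ (f := fun k _ =>
      ∑ Y ∈ headTuples K (Fin n → K) (fun _ => True) r with
        Module.finrank K (LinearMap.ker (idemPow (Y 0))) = k, invMob Y)]
    refine (Finset.sum_fiberwise_of_maps_to (fun Y _ => ?_) _).symm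
    rw [Finset.mem_range, Nat.lt_succ_iff]
    simpa using Submodule.finrank_le (LinearMap.ker (idemPow (Y 0)))
  have hsum' := congrArg (fun z : ℤ => (z : ℚ)) hsum
  push_cast at hsum'
  rw [tupleCoeff, ← mul_div_assoc, hsum', Finset.sum_div]
  refine Finset.sum_congr rfl fun k hk => ?_
  have hk' : k.1 + k.2 = n := HasAntidiagonal.mem_antidiagonal.1 hk
  have h := sum_headTuples_finrank_ker_eq (K := K) (V := Fin n → K) (U₀ := Fin k.2 → K)
    (U₁ := Fin k.1 → K) (by simp; omega) r
  have h := congrArg (fun z : ℤ => (z : ℚ)) h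
  rw [Module.finrank_fin_fun] at h
  push_cast at h
  rw [tupleCoeff, tupleCoeff]
  have := hpos k.1
  have := hpos k.2
  have := hpos n
  field_simp
  linear_combination h

end Recursion

/-! ### The lattice of all subspaces -/

section Base

variable {K : Type*} [Field K] [Finite K]

theorem card_injective_linearMap {n j : ℕ} (h : n ≤ j) :
    (Nat.card {g : (Fin n → K) →ₗ[K] (Fin j → K) // Function.Injective g} : ℤ) =
      ∏ i ∈ range n, ((Nat.card K : ℤ) ^ j - (Nat.card K : ℤ) ^ i) := by
  have e : {s : Fin n → (Fin j → K) // LinearIndependent K s} ≃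
      {g : (Fin n → K) →ₗ[K] (Fin j → K) // Function.Injective g} := by
    refine Equiv.ofBijective (fun s => ⟨Fintype.linearCombination K s.1,
      LinearIndependent.fintypeLinearCombination_injective s.2⟩) ⟨?_, ?_⟩
    · intro s t hst
      refine Subtype.ext (funext fun i => ?_)
      have := LinearMap.congr_fun (congrArg Subtype.val hst) (Pi.single i 1)
      simpa [Fintype.linearCombination_apply_single] using this
    · rintro ⟨g, hg⟩
      have hg' : Fintype.linearCombination K (fun i => g (Pi.single i 1)) = g := by
        refine LinearMap.pi_ext' fun i => LinearMap.ext_ring ?_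
        simp [Fintype.linearCombination_apply_single]
      refine ⟨⟨fun i => g (Pi.single i 1), ?_⟩, Subtype.ext hg'⟩
      rw [Fintype.linearIndependent_iff]
      intro c hc i
      have : g c = 0 := by
        rw [← hg', Fintype.linearCombination_apply, hc]
      rw [(map_eq_zero_iff g hg).1 this]
      rfl
  rw [← Nat.card_congr e, card_linearIndependent (by simpa using h), Module.finrank_fin_fun,
    ← Nat.card_eq_fintype_card, Fin.prod_univ_eq_prod_range
      (fun i => Nat.card K ^ j - Nat.card K ^ i) n, Nat.cast_prod]
  refine Finset.prod_congr rfl fun i hi => ?_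
  rw [Nat.cast_sub (Nat.pow_le_pow_right Nat.card_pos ((Finset.mem_range.1 hi).le.trans h))]
  push_cast
  rfl

theorem card_linearEquiv_fin_fun (n : ℕ) :
    (Nat.card ((Fin n → K) ≃ₗ[K] (Fin n → K)) : ℤ) =
      ∏ i ∈ range n, ((Nat.card K : ℤ) ^ n - (Nat.card K : ℤ) ^ i) := by
  rw [← card_injective_linearMap le_rfl]
  congr 1
  exact Nat.card_congr
    { toFun := fun e => ⟨e, e.injective⟩
      invFun := fun g => LinearEquiv.ofInjectiveEndo g.1 g.2
      left_inv := fun e => by ext; simp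
      right_inv := fun g => by ext; simp }

/-- The characteristic polynomial of the subspace lattice equals ∏ (X - q^i): at X = q^(n+j) both
count injections V → K^(n+j). At X = 0 only W = ⊤ survives. -/
theorem mob_top_eq_prod {V : Type*} [AddCommGroup V] [Module K V] [Finite V] {n : ℕ}
    (hn : Module.finrank K V = n) :
    mob (⊤ : Submodule K V) = ∏ i ∈ range n, -(Nat.card K : ℤ) ^ i := by
  have hK : 1 < Nat.card K := Finite.one_lt_card
  have hpoly : ∑ W : Submodule K V, Polynomial.C (mob W) *
      Polynomial.X ^ (n - Module.finrank K W) =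
      ∏ i ∈ range n, (Polynomial.X - Polynomial.C ((Nat.card K : ℤ) ^ i)) := by
    refine Polynomial.eq_of_infinite_eval_eq _ _ (Set.Infinite.mono ?_
      (Set.infinite_range_of_injective (f := fun j : ℕ => (Nat.card K : ℤ) ^ (n + j)) ?_))
    · rintro _ ⟨j, rfl⟩
      have h := sum_mob_mul_card_le_ker (R := K) V (Fin (n + j) → K)
      have e : V ≃ₗ[K] (Fin n → K) := LinearEquiv.ofFinrankEq _ _ (by simp [hn])
      have e' : {g : V →ₗ[K] (Fin (n + j) → K) // Function.Injective g} ≃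
          {g : (Fin n → K) →ₗ[K] (Fin (n + j) → K) // Function.Injective g} :=
        (e.arrowCongr (LinearEquiv.refl K (Fin (n + j) → K))).toEquiv.subtypeEquiv fun g =>
          (Function.Injective.of_comp_iff' g e.symm.bijective).symm
      rw [Nat.card_congr e', card_injective_linearMap (Nat.le_add_right n j)] at h
      simp_rw [card_le_ker, Module.finrank_fin_fun, hn] at h
      simp only [Set.mem_ofPred_eq, Polynomial.eval_finsetSum, Polynomial.eval_mul,
        Polynomial.eval_C, Polynomial.eval_pow, Polynomial.eval_X, Polynomial.eval_prod,
        Polynomial.eval_sub]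
      rw [← h]
      have hpow : ∀ d : ℕ, ((Nat.card K : ℤ) ^ (n + j)) ^ d =
          ((Nat.card K ^ (d * (n + j)) : ℕ) : ℤ) := by
        intro d
        rw [Nat.cast_pow, ← pow_mul, mul_comm d]
      simp only [hpow]
    · intro i j h
      have h' : Nat.card K ^ (n + i) = Nat.card K ^ (n + j) := by
        simp only at h
        exact_mod_cast h
      have := Nat.pow_right_injective hK h'
      omega
  have h := congrArg (Polynomial.eval 0) hpoly
  simp only [Polynomial.eval_finsetSum, Polynomial.eval_mul,
    Polynomial.eval_C, Polynomial.eval_pow, Polynomial.eval_X, Polynomial.eval_prod,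
    Polynomial.eval_sub, zero_sub] at h
  rw [← h, Finset.sum_eq_single ⊤]
  · simp [hn]
  · intro W _ hW
    have := Submodule.finrank_lt hW
    rw [hn] at this
    rw [zero_pow (by omega), mul_zero]
  · simp

theorem tupleSum_zero_right (K V : Type*) [Field K] [AddCommGroup V] [Module K V]
    [Finite V] : tupleSum K V 0 = mob (⊤ : Submodule K V) := by
  rw [tupleSum, commTuples, Finset.filter_true_of_mem (fun _ _ => ⟨fun i => i.elim0,
    fun i => i.elim0⟩)]
  simp [invMob_eq_mob_top]

theorem tupleCoeff_zero_right (r : ℕ) : tupleCoeff K r 0 = 1 := by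
  have h : commTuples K (Fin 0 → K) r = univ := by
    ext Y
    simp only [mem_commTuples, mem_univ, iff_true]
    exact ⟨fun i => isUnit_of_subsingleton _, fun i j => Subsingleton.elim _ _⟩
  rw [tupleCoeff, tupleSum, h]
  simp [invMob_of_subsingleton]

/-- This is T_0(qx) = (1 - x) T_0(x) on coefficients. From n to n + 1 the Möbius number gains the
factor -q^n and the group order the factor (q^(n+1) - 1) q^n |K|^n / q^n, that is, (q^(n+1) - 1)
q^n. -/
theorem tupleCoeff_zero_left_succ (n : ℕ) :
    (Nat.card K : ℚ) ^ (n + 1) * tupleCoeff K 0 (n + 1) =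
      tupleCoeff K 0 (n + 1) - tupleCoeff K 0 n := by
  have hK : (1 : ℚ) < Nat.card K := by exact_mod_cast Finite.one_lt_card (α := K)
  have h1 := fun m => congrArg (fun z : ℤ => (z : ℚ)) (card_linearEquiv_fin_fun (K := K) m)
  have h2 := fun m => congrArg (fun z : ℤ => (z : ℚ)) (mob_top_eq_prod (K := K) (V := Fin m → K)
    (Module.finrank_fin_fun K))
  push_cast at h1 h2
  have hne : ∀ m : ℕ, (Nat.card ((Fin m → K) ≃ₗ[K] (Fin m → K)) : ℚ) ≠ 0 := fun m =>
    Nat.cast_ne_zero.2 Nat.card_pos.ne'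
  have hgl : (Nat.card ((Fin (n + 1) → K) ≃ₗ[K] (Fin (n + 1) → K)) : ℚ) =
      ((Nat.card K : ℚ) ^ (n + 1) - 1) * (Nat.card K : ℚ) ^ n *
        Nat.card ((Fin n → K) ≃ₗ[K] (Fin n → K)) := by
    rw [h1, h1, Finset.prod_range_succ', pow_zero]
    have : ∀ i, (Nat.card K : ℚ) ^ (n + 1) - (Nat.card K : ℚ) ^ (i + 1) =
        Nat.card K * ((Nat.card K : ℚ) ^ n - (Nat.card K : ℚ) ^ i) := fun i => by ring
    simp_rw [this]
    rw [Finset.prod_mul_distrib, Finset.prod_const, card_range]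
    ring
  have hne1 : ((Nat.card K : ℚ) ^ (n + 1) - 1) ≠ 0 :=
    (sub_pos.2 (one_lt_pow₀ hK (by omega))).ne'
  have hne2 : (Nat.card K : ℚ) ^ n ≠ 0 := pow_ne_zero _ (by linarith)
  have hmob : (mob (⊤ : Submodule K (Fin (n + 1) → K)) : ℚ) =
      -(Nat.card K : ℚ) ^ n * mob (⊤ : Submodule K (Fin n → K)) := by
    rw [h2, h2, Finset.prod_range_succ, mul_comm]
  rw [tupleCoeff, tupleCoeff, tupleSum_zero_right, tupleSum_zero_right, hgl, hmob]
  have := hne n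
  field_simp
  ring

end Base

/-! ### Generating functions -/

section Series

variable (K : Type*) [Field K] [Finite K]

/-- The generating function of the sums over commuting tuples. -/
noncomputable def tupleSeries (r : ℕ) : ℚ⟦X⟧ := PowerSeries.mk (tupleCoeff K r)

theorem tupleSeries_succ_mul (r : ℕ) :
    tupleSeries K (r + 1) * tupleSeries K r =
      PowerSeries.rescale (Nat.card K : ℚ) (tupleSeries K r) := by
  ext n
  simp only [tupleSeries, PowerSeries.coeff_mul, PowerSeries.coeff_mk, PowerSeries.coeff_rescale]
  exact (card_pow_mul_tupleCoeff K r n).symm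

theorem constantCoeff_tupleSeries (r : ℕ) : PowerSeries.constantCoeff (tupleSeries K r) = 1 := by
  rw [← PowerSeries.coeff_zero_eq_constantCoeff_apply, tupleSeries, PowerSeries.coeff_mk,
    tupleCoeff_zero_right]

theorem tupleSeries_ne_zero (r : ℕ) : tupleSeries K r ≠ 0 := fun h => by
  have := constantCoeff_tupleSeries K r
  rw [h, map_zero] at this
  exact zero_ne_one this

theorem tupleSeries_one : tupleSeries K 1 = 1 - PowerSeries.X := by
  refine mul_right_cancel₀ (tupleSeries_ne_zero K 0) ?_
  rw [tupleSeries_succ_mul, sub_mul, one_mul]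
  ext n
  rcases n with _ | n
  · simp [tupleSeries]
  · rw [map_sub, PowerSeries.coeff_succ_X_mul, PowerSeries.coeff_rescale]
    simp only [tupleSeries, PowerSeries.coeff_mk]
    exact tupleCoeff_zero_left_succ n

end Series

/-! ### From the functional equation to the exponential formula. -/

section Exp

open PowerSeries in
-- Both sides solve y' = y a' with constant term 1, so their quotient has derivative zero.
theorem eq_exp_subst {G a : ℚ⟦X⟧} (ha : constantCoeff a = 0) (hG : constantCoeff G = 1)
    (h : derivative ℚ G = G * derivative ℚ a) : G = (exp ℚ).subst a := by
  have hs : HasSubst a := HasSubst.of_constantCoeff_zero' ha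
  set H := (exp ℚ).subst a with hH
  have hH1 : constantCoeff H = 1 := by
    have h0 : constantCoeff ((exp ℚ - 1).subst a) = 0 :=
      constantCoeff_subst_eq_zero ha _ (by simp)
    rw [← coe_substAlgHom hs, map_sub, map_one, coe_substAlgHom hs, ← hH, map_sub, map_one] at h0
    exact sub_eq_zero.1 h0
  have hH' : derivative ℚ H = H * derivative ℚ a := by
    rw [hH, derivative_subst hs, derivative_exp]
  have hHH : H * H⁻¹ = 1 := PowerSeries.mul_inv_cancel _ (by rw [hH1]; exact one_ne_zero)
  have key : G * H⁻¹ = 1 := by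
    refine derivative.ext ?_ ?_
    · rw [Derivation.leibniz, derivative_inv', h, hH', smul_eq_mul, smul_eq_mul,
        Derivation.map_one_eq_zero]
      linear_combination (- G * H⁻¹ * derivative ℚ a) * hHH
    · rw [map_mul, constantCoeff_inv, hG, hH1]
      simp
  calc G = G * (H * H⁻¹) := by rw [hHH, mul_one]
    _ = (G * H⁻¹) * H := by ring
    _ = H := by rw [key, one_mul]

open PowerSeries in
theorem derivative_rescale (q : ℚ) (f : ℚ⟦X⟧) :
    derivative ℚ (rescale q f) = C q * rescale q (derivative ℚ f) := by
  ext n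
  simp only [coeff_derivative, coeff_rescale, coeff_C_mul]
  ring

theorem constantCoeff_exponentSeries (r q : ℕ) :
    PowerSeries.constantCoeff (exponentSeries r q) = 0 := by
  rw [← PowerSeries.coeff_zero_eq_constantCoeff_apply, exponentSeries, PowerSeries.coeff_mk]
  simp

/-- The logarithm of the functional equation. The indices start at 1 and 2 to keep the subtraction
in the exponent r - 1 from truncating. -/
theorem exponentSeries_succ_add (r q : ℕ) :
    exponentSeries (r + 2) q + exponentSeries (r + 1) q =
      PowerSeries.rescale (q : ℚ) (exponentSeries (r + 1) q) := by
  ext n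
  simp only [exponentSeries, map_add, PowerSeries.coeff_mk, PowerSeries.coeff_rescale]
  split_ifs
  · simp
  · simp only [Nat.add_sub_cancel, show r + 2 - 1 = r + 1 by omega]
    ring

open PowerSeries in
theorem derivative_exponentSeries_one (q : ℕ) :
    derivative ℚ (exponentSeries 1 q) * (1 - X) = 1 := by
  have h : derivative ℚ (exponentSeries 1 q) = PowerSeries.mk 1 := by
    ext n
    have : (n : ℚ) + 1 ≠ 0 := by positivity
    simp [coeff_derivative, exponentSeries, this]
  rw [h, mk_one_mul_one_sub_eq_one]

open PowerSeries in
/-- The differential equation characterizing the exponential formula. -/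
theorem derivative_tupleSeries (K : Type*) [Field K] [Finite K] (r : ℕ) :
    derivative ℚ (tupleSeries K (r + 1)) =
      tupleSeries K (r + 1) * derivative ℚ (-exponentSeries (r + 1) (Nat.card K)) := by
  induction r with
  | zero =>
    rw [zero_add, tupleSeries_one, map_neg, map_sub, Derivation.map_one_eq_zero, derivative_X]
    linear_combination derivative_exponentSeries_one (Nat.card K)
  | succ r ih =>
    refine mul_right_cancel₀ (tupleSeries_ne_zero K (r + 1)) ?_
    -- Differentiate the functional equation, insert the induction hypothesis, and compare with the
    -- derivative of its additive form for the exponents.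
    have h1 := tupleSeries_succ_mul K (r + 1)
    have h2 := congrArg (derivative ℚ) h1
    have h3 := congrArg (derivative ℚ) (exponentSeries_succ_add r (Nat.card K))
    rw [Derivation.leibniz, derivative_rescale, ih, smul_eq_mul, smul_eq_mul, map_mul, ← h1,
      map_neg] at h2
    rw [map_add, derivative_rescale] at h3
    rw [map_neg] at ih ⊢
    simp only [map_neg] at h2
    rw [show r + 1 + 1 = r + 2 by omega] at *
    linear_combination h2 + tupleSeries K (r + 2) * tupleSeries K (r + 1) * h3

theorem tupleSeries_eq_exp (K : Type*) [Field K] [Finite K] (r : ℕ) :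
    tupleSeries K (r + 1) =
      (PowerSeries.exp ℚ).subst (-exponentSeries (r + 1) (Nat.card K)) :=
  eq_exp_subst (by rw [map_neg, constantCoeff_exponentSeries, neg_zero])
    (constantCoeff_tupleSeries K _) (derivative_tupleSeries K r)

end Exp

/-- The generating functions are the values of a power series over `ℤ[X]`. -/
theorem exists_universal_series.{u} (r : ℕ) :
    ∃ F : ℤ[X]⟦X⟧, PowerSeries.constantCoeff F = 1 ∧ ∀ (K : Type u) [Field K] [Finite K],
      tupleSeries K (r + 1) =
        (F.map (Polynomial.evalRingHom (Nat.card K : ℤ))).map (Int.castRingHom ℚ) := by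
  induction r with
  | zero =>
    refine ⟨1 - PowerSeries.X, by simp, fun K _ _ => ?_⟩
    rw [zero_add, tupleSeries_one]
    simp
  | succ r ih =>
    obtain ⟨F, hF, h⟩ := ih
    have hinv := PowerSeries.mul_invOfUnit F 1 (by simpa using hF)
    -- The quotient F(qx) / F(x) has coefficients in ℤ[q] because F has constant term 1.
    refine ⟨PowerSeries.rescale Polynomial.X F * F.invOfUnit 1, ?_, fun K _ _ => ?_⟩
    · rw [map_mul, PowerSeries.constantCoeff_invOfUnit, ← PowerSeries.coeff_zero_eq_constantCoeff,
        PowerSeries.coeff_rescale, PowerSeries.coeff_zero_eq_constantCoeff_apply, hF]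
      simp
    · refine mul_right_cancel₀ (tupleSeries_ne_zero K (r + 1)) ?_
      rw [tupleSeries_succ_mul, h K, ← map_mul, ← map_mul, mul_assoc, mul_comm _ F, hinv, mul_one,
        ← PowerSeries.rescale_map, ← PowerSeries.rescale_map]
      simp

/-! ### Equivariant Euler characteristics as sums over commuting tuples -/

section FreeAb

variable {r : ℕ}

/-- The standard generators of `ℤ ^ r`. -/
abbrev FreeAb.gen (i : Fin r) : FreeAb r := Multiplicative.ofAdd (Pi.single i 1)

theorem FreeAb.mem_of_gen_mem (H : Subgroup (FreeAb r)) (h : ∀ i, FreeAb.gen i ∈ H)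
    (v : FreeAb r) : v ∈ H := by
  have hv : v = ∏ i, FreeAb.gen i ^ (v.toAdd i) := by
    have : ∀ i, (FreeAb.gen i ^ (v.toAdd i) : FreeAb r) =
        Multiplicative.ofAdd (Pi.single i (v.toAdd i)) := by
      intro i
      rw [← ofAdd_zsmul, ← Pi.single_smul]
      simp
    simp_rw [this]
    rw [← ofAdd_sum, Finset.univ_sum_single, ofAdd_toAdd]
  rw [hv]
  exact Subgroup.prod_mem _ fun i _ => H.zpow_mem (h i) _

theorem FreeAb.hom_ext {G : Type*} [Group G] {X Y : FreeAb r →* G}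
    (h : ∀ i, X (FreeAb.gen i) = Y (FreeAb.gen i)) : X = Y :=
  MonoidHom.ext fun v => FreeAb.mem_of_gen_mem (X.eqLocus Y) h v

theorem FreeAb.exists_hom {G : Type*} [Group G] (u : Fin r → G)
    (hu : ∀ i j, Commute (u i) (u j)) : ∃ X : FreeAb r →* G, ∀ i, X (FreeAb.gen i) = u i := by
  have hcomm : Pairwise fun i j => ∀ x y : Multiplicative ℤ,
      Commute (zpowersHom G (u i) x) (zpowersHom G (u j) y) := by
    intro i j _ x y
    rw [zpowersHom_apply, zpowersHom_apply]
    exact ((hu i j).zpow_left _).zpow_right _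
  refine ⟨(MonoidHom.noncommPiCoprod (fun i => zpowersHom G (u i)) hcomm).comp
    (MulEquiv.piMultiplicative fun _ : Fin r => ℤ).toMonoidHom, fun i => ?_⟩
  have : (MulEquiv.piMultiplicative fun _ : Fin r => ℤ) (FreeAb.gen i) =
      Pi.mulSingle i (Multiplicative.ofAdd 1) := by
    funext j
    by_cases hj : j = i
    · subst hj; simp
    · simp [hj]
  rw [MonoidHom.comp_apply, MulEquiv.toMonoidHom_eq_coe, MonoidHom.coe_coe, this,
    MonoidHom.noncommPiCoprod_mulSingle]
  simp

end FreeAb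

section Bridge

variable {K V : Type*} [Field K] [AddCommGroup V] [Module K V] [Finite V] {r : ℕ}

theorem mem_fixedPoints_iff (X : FreeAb r →* LinearMap.GeneralLinearGroup K V)
    (W : ProperSubspace K V) :
    W ∈ MulAction.fixedPoints X.range (ProperSubspace K V) ↔
      ∀ i, W.1 ≤ W.1.comap (X (FreeAb.gen i) : Module.End K V) := by
  constructor
  · intro h i
    have := congrArg Subtype.val (h ⟨X (FreeAb.gen i), _, rfl⟩)
    exact Submodule.map_le_iff_le_comap.1 this.le
  · intro h
    have hstab : ∀ v, X v ∈ MulAction.stabilizer (LinearMap.GeneralLinearGroup K V) W := by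
      refine FreeAb.mem_of_gen_mem ((MulAction.stabilizer _ W).comap X) fun i => ?_
      refine Subtype.ext ?_
      change W.1.map (X (FreeAb.gen i) : Module.End K V) = W.1
      -- An automorphism mapping W into itself maps it onto itself, by dimension.
      refine Submodule.eq_of_le_of_finrank_le (Submodule.map_le_iff_le_comap.2 (h i)) ?_
      exact (LinearEquiv.finrank_map_eq
        (LinearMap.GeneralLinearGroup.toLinearEquiv (X (FreeAb.gen i))) W.1).ge
    rintro ⟨_, v, rfl⟩
    exact hstab v

/-- Nontriviality matters: for V = 0 the empty poset has value -1, whereas `invMob` is 1, in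
agreement with the constant coefficient of the generating function. -/
theorem reducedEulerChar_fixedPoints [Nontrivial V]
    (X : FreeAb r →* LinearMap.GeneralLinearGroup K V) :
    reducedEulerChar (MulAction.fixedPoints X.range (ProperSubspace K V)) =
      invMob fun i => (X (FreeAb.gen i) : Module.End K V) := by
  have hne : (⊤ : InvSub fun i => (X (FreeAb.gen i) : Module.End K V)) ≠ ⊥ := fun h =>
    top_ne_bot (congrArg Subtype.val h : (⊤ : Submodule K V) = ⊥)
  rw [invMob, mob, if_neg hne]
  refine reducedEulerChar_congr
    { toFun := fun W => ⟨⟨W.1.1, (mem_fixedPoints_iff X W.1).1 W.2⟩,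
        fun h => W.1.2.1 (congrArg Subtype.val h),
        lt_top_iff_ne_top.2 fun h => W.1.2.2 (congrArg Subtype.val h)⟩
      invFun := fun W => ⟨⟨W.1.1, fun h => W.2.1 (Subtype.ext h),
        fun h => W.2.2.ne (Subtype.ext h)⟩, (mem_fixedPoints_iff X _).2 W.1.2⟩
      left_inv := fun _ => rfl
      right_inv := fun _ => rfl
      map_rel_iff' := Iff.rfl }

theorem equivariantReducedEulerChar_eq [Nontrivial V] :
    equivariantReducedEulerChar r (ProperSubspace K V) (LinearMap.GeneralLinearGroup K V) =
      tupleSum K V r / Nat.card (V ≃ₗ[K] V) := by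
  rw [equivariantReducedEulerChar,
    Nat.card_congr (LinearMap.GeneralLinearGroup.generalLinearEquiv K V).toEquiv,
    finsum_eq_sum_of_fintype, tupleSum, Int.cast_sum]
  congr 1
  refine Finset.sum_bij (fun X _ i => (X (FreeAb.gen i) : Module.End K V)) ?_ ?_ ?_ ?_
  · intro X _
    rw [mem_commTuples]
    refine ⟨fun i => Units.isUnit _, fun i j => ?_⟩
    exact Units.val_injective.eq_iff.2 ((Commute.all (FreeAb.gen i) (FreeAb.gen j)).map X).eq
  · intro X _ Y _ h
    exact FreeAb.hom_ext fun i => Units.ext (congrFun h i)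
  · intro Y hY
    rw [mem_commTuples] at hY
    choose u hu using hY.1
    obtain ⟨X, hX⟩ := FreeAb.exists_hom u fun i j => Units.ext (by
      have := (hY.2 i j).eq
      rwa [← hu, ← hu] at this)
    exact ⟨X, mem_univ _, funext fun i => by rw [hX, hu]⟩
  · intro X _
    rw [reducedEulerChar_fixedPoints]

end Bridge

theorem generatingFunction_eq_tupleSeries (r : ℕ) (K : Type*) [Field K] [Finite K] :
    generatingFunction r K = tupleSeries K r := by
  ext n
  rw [generatingFunction, tupleSeries, PowerSeries.coeff_mk, PowerSeries.coeff_mk]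
  split_ifs with hn
  · rw [hn, tupleCoeff_zero_right]
  · have : Nonempty (Fin n) := ⟨⟨0, Nat.pos_of_ne_zero hn⟩⟩
    rw [equivariantReducedEulerChar_eq, tupleCoeff]

end

/-- For every `r ≥ 1`: there is a power series `F` with coefficients in `ℤ[q]` whose evaluation at
every prime power `q = |K|` (`K` a finite field) is the `r`-th generating function at `q`, and that
evaluation is `exp (- ∑_{n ≥ 1} (q ^ n - 1) ^ (r - 1) x ^ n / n)`. -/
theorem theorem1p3 (r : ℕ) (hr : 1 ≤ r) :
    ∃ F : ℤ[X]⟦X⟧, ∀ (K : Type*) [Field K] [Finite K],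
      generatingFunction r K =
          ((F.map (Polynomial.evalRingHom (Nat.card K : ℤ))).map (Int.castRingHom ℚ)) ∧
        generatingFunction r K =
          (PowerSeries.exp ℚ).subst (-exponentSeries r (Nat.card K)) := by
  obtain ⟨m, rfl⟩ : ∃ m, r = m + 1 := ⟨r - 1, by omega⟩
  obtain ⟨F, -, hF⟩ := exists_universal_series m
  refine ⟨F, fun K _ _ => ?_⟩
  rw [generatingFunction_eq_tupleSeries]
  exact ⟨hF K, tupleSeries_eq_exp K m⟩
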